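/- **Theorem 5.1 (thm:accuracyps2).** Let $A\in\mathbb{R}^{m\times n}$ with $m\ge n$ (or $A\in\mathbb{C}^{m\times n}$, with the transpose replaced by the conjugate transpose), let $A=U\begin{pmatrix}\Sigma\\0\end{pmatrix}V^T$ be a singular value decomposition with $\Sigma=\mathrm{diag}(\sigma_1,\dots,\sigma_n)$, $\sigma_i\ge 0$, and write $U=[U_n\,|\,\hat U]$ with $U_n$ the first $n$ columns. Let $\|\cdot\|$ be the matrix 2-norm, let $0<a<b<\|A\|$, let $d\ge 0$ be an integer, and put $l(x)=x/\|A\|$. Let $$S_A=\begin{bmatrix}0&A^T\\A&0\end{bmatrix},\qquad Q=\frac1{\sqrt2}\begin{bmatrix}V&V&0\\U_n&-U_n&\sqrt2\,\hat U\end{bmatrix},$$ so that the columns of $Q$ are eigenvectors of $S_A$ for its spectrum $\mathcal L=\{\sigma_1,\dots,\sigma_n,-\sigma_1,\dots,-\sigma_n,0,\dots,0\}$ ($m-n$ zeros, multiplicities counted). Let $P_{S_A}=Q_{in}Q_{in}^T+\frac12Q_{ab}Q_{ab}^T$, where $Q_{in}$ and $Q_{ab}$ consist of those among the first $n$ columns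 of $Q$ whose singular value lies in $(a,b)$, respectively equals $a$ or $b$. With $\alpha=\arccos(l(a))$, $\beta=\arccos(l(b))$, let $c_0=\frac1\pi(\alpha-\beta)$, $c_j=\frac2\pi\,\frac{\sin(j\alpha)-\sin(j\beta)}{j}$ for $j\ge1$, $$\rho_{j,d}=\frac{(d+2-j)\sin\frac{\pi}{d+2}\cos\frac{j\pi}{d+2}+\cos\frac{\pi}{d+2}\sin\frac{j\pi}{d+2}}{(d+2)\sin\frac{\pi}{d+2}},\qquad \phi_d=\sum_{j=0}^d\rho_{j,d}\,c_j\,T_j,\qquad P=\phi_d(l(S_A)),$$ where $T_j$ is the Chebyshev polynomial of the first kind. Let $\sigma_{il}$ be the singular value in $(a,b]$ closest to $a$, $\sigma_{ir}$ the singular value in $[a,b)$ closest to $b$, $\sigma_{or}$ the smallest singular value above $b$, and $\sigma_{ol}$ the largest singular value below $a$ (if no singular value lies below $a$, let $\sigma_{ol}$ be the largest eigenvalue of $S_A$ below $a$, which is $0$ if $m>n$ and $-\min_i\sigma_i$ if $m=n$). Put $\Delta_{il}=|\arccos(l(\sigma_{il}))-\alpha|$, $\Delta_{ol}=|\arccos(l(\sigma_{ol}))-\alpha|$,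 $\Delta_{ir}=|\arccos(l(\sigma_{ir}))-\beta|$, $\Delta_{or}=|\arccos(l(\sigma_{or}))-\beta|$, and let $\Delta_{\min}$ be the minimum of these four numbers, leaving out $\Delta_{il}$ or $\Delta_{ir}$ if no such singular value exists. Then $\Delta_{\min}>0$ and $$\|P_{S_A}-P\|\le\frac{\pi^6}{2(d+2)^3\Delta_{\min}^4}.$$ The eigenvalues of $P$, with multiplicities, are $\phi_d(l(\lambda))$, $\lambda\in\mathcal L$. If moreover $$d>\frac{\sqrt[3]{2}\,\pi^2}{\Delta_{\min}^{4/3}}-2,$$ then $\|P_{S_A}-P\|<\frac14$ and, for $\lambda\in\mathcal L$: $\frac34<\phi_d(l(\lambda))\le1$ if $\lambda\in(a,b)$; $\frac14<\phi_d(l(\lambda))<\frac34$ if $\lambda\in\{a,b\}$; $0\le\phi_d(l(\lambda))<\frac14$ if $\lambda\notin[a,b]$. Consequently, if $n_{sv}$ and $r$ are the numbers of singular values, with multiplicity, in $[a,b]$ and $(a,b)$, if $\gamma_1\ge\dots\ge\gamma_{n_{sv}}$ are the numbers $\phi_d(l(\sigma_i))$ with $\sigma_i\in[a,b]$ and $\gamma_{n_{sv}+1}\ge\dots\ge\gamma_{m+n}$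 are the numbers $\phi_d(l(\lambda))$ for the remaining $\lambda\in\mathcal L$, then $\gamma_1,\dots,\gamma_r$ belong to the singular values in $(a,b)$, $\gamma_{r+1},\dots,\gamma_{n_{sv}}$ to those equal to $a$ or $b$, and $$1\ge\gamma_1\ge\dots\ge\gamma_r>\tfrac34>\gamma_{r+1}\ge\dots\ge\gamma_{n_{sv}}>\tfrac14>\gamma_{n_{sv}+1}\ge\dots\ge\gamma_{m+n}\ge0.$$ -/

import Mathlib

open scoped Matrix Matrix.Norms.L2Operator

namespace CJFeast

/-! Throughout, `‖·‖` of a matrix is the spectral norm (the matrix 2-norm). -/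

section SVD

variable {𝕜 : Type*} [RCLike 𝕜] {m n : ℕ}

/-- The `m × n` matrix whose top part is `diag(σ₁, …, σₙ)` and whose remaining rows vanish. -/
noncomputable def sigmaMatrix (𝕜 : Type*) [RCLike 𝕜] (m : ℕ) {n : ℕ} (σ : Fin n → ℝ) :
    Matrix (Fin m) (Fin n) 𝕜 :=
  Matrix.of fun i j => if (i : ℕ) = (j : ℕ) then ((σ j : ℝ) : 𝕜) else 0

/-- `A = U (Σ; 0) Vᴴ` is a singular value decomposition of `A`: `U` and `V` are unitary
(orthogonal when `𝕜 = ℝ`) and the singular values `σ j` are non-negative, in any order. -/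
structure IsSVD (A : Matrix (Fin m) (Fin n) 𝕜) (U : Matrix (Fin m) (Fin m) 𝕜)
    (σ : Fin n → ℝ) (V : Matrix (Fin n) (Fin n) 𝕜) : Prop where
  left_unitary : U ∈ Matrix.unitaryGroup (Fin m) 𝕜
  right_unitary : V ∈ Matrix.unitaryGroup (Fin n) 𝕜
  nonneg : ∀ j, 0 ≤ σ j
  decomposition : A = U * sigmaMatrix 𝕜 m σ * Vᴴ

/-- The augmented matrix `S_A = [0, Aᴴ; A, 0]`. -/
def augmented (A : Matrix (Fin m) (Fin n) 𝕜) :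
    Matrix (Fin n ⊕ Fin m) (Fin n ⊕ Fin m) 𝕜 :=
  Matrix.fromBlocks 0 Aᴴ A 0

/-- The first `n` columns of `U`. -/
def leftCols (hmn : n ≤ m) (U : Matrix (Fin m) (Fin m) 𝕜) : Matrix (Fin m) (Fin n) 𝕜 :=
  U.submatrix id (Fin.castLE hmn)

/-- The last `m - n` columns of `U`. -/
def rightCols (hmn : n ≤ m) (U : Matrix (Fin m) (Fin m) 𝕜) : Matrix (Fin m) (Fin (m - n)) 𝕜 :=
  U.submatrix id (fun j => Fin.cast (Nat.add_sub_of_le hmn) (Fin.natAdd n j))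

/-- The eigenvector matrix `Q = 1/√2 [V, V, 0; Uₙ, -Uₙ, √2 Û]` of `S_A`, where `U = [Uₙ | Û]`. -/
noncomputable def eigenvectorMatrix (hmn : n ≤ m) (U : Matrix (Fin m) (Fin m) 𝕜)
    (V : Matrix (Fin n) (Fin n) 𝕜) :
    Matrix (Fin n ⊕ Fin m) (Fin n ⊕ (Fin n ⊕ Fin (m - n))) 𝕜 :=
  (1 / √2 : ℝ) • Matrix.fromBlocks
    V (Matrix.fromCols V 0)
    (leftCols hmn U) (Matrix.fromCols (-leftCols hmn U) (√2 • rightCols hmn U))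

/-- The eigenvalues `σ₁, …, σₙ, -σ₁, …, -σₙ, 0, …, 0` (`m - n` zeros) of `S_A`, in the order
of the columns of `eigenvectorMatrix`. -/
def augEigenvalue (m : ℕ) {n : ℕ} (σ : Fin n → ℝ) : Fin n ⊕ (Fin n ⊕ Fin (m - n)) → ℝ :=
  Sum.elim σ (Sum.elim (fun j => -σ j) (fun _ => 0))

/-- The columns of `Q` that belong to the singular values lying in the set `I`. -/
noncomputable def selectedCols (hmn : n ≤ m) (U : Matrix (Fin m) (Fin m) 𝕜) (σ : Fin n → ℝ)
    (V : Matrix (Fin n) (Fin n) 𝕜) (I : Set ℝ) :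
    Matrix (Fin n ⊕ Fin m) {j : Fin n // σ j ∈ I} 𝕜 :=
  (eigenvectorMatrix hmn U V).submatrix id (fun j => Sum.inl j.1)

open Classical in
/-- The spectral projector `P_{S_A} = Q_in Q_inᴴ + 1/2 Q_ab Q_abᴴ`. -/
noncomputable def spectralProjector (hmn : n ≤ m) (U : Matrix (Fin m) (Fin m) 𝕜)
    (σ : Fin n → ℝ) (V : Matrix (Fin n) (Fin n) 𝕜) (a b : ℝ) :
    Matrix (Fin n ⊕ Fin m) (Fin n ⊕ Fin m) 𝕜 :=
  selectedCols hmn U σ V (Set.Ioo a b) * (selectedCols hmn U σ V (Set.Ioo a b))ᴴ +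
    (1 / 2 : ℝ) • (selectedCols hmn U σ V {a, b} * (selectedCols hmn U σ V {a, b})ᴴ)

end SVD

/-- The Chebyshev coefficients `c_j` of the step function of the interval
`[a, b] ⊆ [-1, 1]`. -/
noncomputable def chebCoeff (a b : ℝ) (j : ℕ) : ℝ :=
  if j = 0 then 1 / Real.pi * (Real.arccos a - Real.arccos b)
  else 2 / Real.pi * ((Real.sin (j * Real.arccos a) - Real.sin (j * Real.arccos b)) / j)

/-- The Jackson damping factors `ρ_{j,d}`. -/
noncomputable def jackson (d j : ℕ) : ℝ :=
  (((d : ℝ) + 2 - j) * Real.sin (Real.pi / (d + 2)) * Real.cos (j * Real.pi / (d + 2)) +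
      Real.cos (Real.pi / (d + 2)) * Real.sin (j * Real.pi / (d + 2))) /
    (((d : ℝ) + 2) * Real.sin (Real.pi / (d + 2)))

/-- The Chebyshev–Jackson polynomial `φ_d = ∑_{j ≤ d} ρ_{j,d} c_j T_j` of the step function of
the interval `[a, b] ⊆ [-1, 1]`. -/
noncomputable def chebJackson (a b : ℝ) (d : ℕ) : Polynomial ℝ :=
  ∑ j ∈ Finset.range (d + 1),
    Polynomial.C (jackson d j * chebCoeff a b j) * Polynomial.Chebyshev.T ℝ (j : ℤ)

section Projector

variable {𝕜 : Type*} [RCLike 𝕜] {m n : ℕ}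

/-- The polynomial `φ_d` for the interval `[l(a), l(b)]`, where `l(x) = x / ‖A‖`. -/
noncomputable def scaledChebJackson (A : Matrix (Fin m) (Fin n) 𝕜) (a b : ℝ) (d : ℕ) :
    Polynomial ℝ :=
  chebJackson (a / ‖A‖) (b / ‖A‖) d

/-- The approximate spectral projector `P = φ_d(S_A / ‖A‖)`. -/
noncomputable def approxProjector (A : Matrix (Fin m) (Fin n) 𝕜) (a b : ℝ) (d : ℕ) :
    Matrix (Fin n ⊕ Fin m) (Fin n ⊕ Fin m) 𝕜 :=
  Polynomial.aeval ((‖A‖⁻¹ : ℝ) • augmented A) (scaledChebJackson A a b d)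

end Projector

/-- `|arccos(l(s)) - arccos(l(c))|` with `l(x) = x / N`. -/
noncomputable def arccosGap (N s c : ℝ) : ℝ :=
  |Real.arccos (s / N) - Real.arccos (c / N)|

/-- Those of the four gaps `Δ_il`, `Δ_ir`, `Δ_ol`, `Δ_or` that are defined, with `N = ‖A‖`.

* `Δ_il`: from `a` to the closest singular value in `(a, b]`;
* `Δ_ir`: from `b` to the closest singular value in `[a, b)`;
* `Δ_ol`: from `a` to the closest eigenvalue of `S_A` below `a`. As singular values are
  eigenvalues of `S_A` and the other eigenvalues are not positive, this is the closest singular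
  value below `a` whenever there is one; otherwise it is the largest non-positive eigenvalue.
* `Δ_or`: from `b` to the closest singular value above `b`. -/
def gaps (m : ℕ) {n : ℕ} (σ : Fin n → ℝ) (N a b : ℝ) : Set ℝ :=
  {δ | (∃ s, IsLeast {x | x ∈ Set.range σ ∧ a < x ∧ x ≤ b} s ∧ δ = arccosGap N s a) ∨
    (∃ s, IsGreatest {x | x ∈ Set.range σ ∧ a ≤ x ∧ x < b} s ∧ δ = arccosGap N s b) ∨
    (∃ s, IsGreatest {x | x ∈ Set.range (augEigenvalue m σ) ∧ x < a} s ∧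
      δ = arccosGap N s a) ∨
    (∃ s, IsLeast {x | x ∈ Set.range σ ∧ b < x} s ∧ δ = arccosGap N s b)}

/-- `Δ_min`, the smallest of these finitely many gaps. -/
noncomputable def deltaMin (m : ℕ) {n : ℕ} (σ : Fin n → ℝ) (N a b : ℝ) : ℝ :=
  sInf (gaps m σ N a b)

/-- The number of singular values, with multiplicity, in the set `I`. -/
noncomputable def countIn {n : ℕ} (σ : Fin n → ℝ) (I : Set ℝ) : ℕ :=
  Nat.card {j : Fin n // σ j ∈ I}

end CJFeast

/-!
By `x = cos θ` the Chebyshev–Jackson polynomial becomes the convolution of the step function of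
`[a, b]`, read as an even function of the angle, with the Jackson kernel
`J(t) = 1 + 2 ∑ ρ_{j,d} cos (j t)` (`eval_chebJackson_cos`). Three properties of `J` give the
pointwise estimates.

* `J ≥ 0`: with `N = d + 2`, the factors `ρ_{j,d}` are the autocorrelations of the sequence
  `sin (k π / N)`, so that `J(t)` is a positive multiple of `|∑ₖ sin (k π / N) exp (i k t)|²`
  (`jacksonKernel_nonneg`).
* The total mass of `J` over a period is `2π`, so that together with positivity the values of
  the polynomial lie in `[0, 1]` (`eval_chebJackson_mem_Icc`).
* The moment `∫ J(t) (1 - cos t)² dt` only involves `ρ_{1,d}` and `ρ_{2,d}` and is at most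
  `4 π³ / N³`. As `1 - cos t ≥ 2 Δ² / π²` at distance at least `Δ` from the multiples of `2π`, the
  mass of `J` there is at most `2π · π⁶ / (2 N³ Δ⁴)` (`integral_jacksonKernel_tail_le`).

At an angle at distance at least `Δ` from the jumps of the step function only this tail
contributes to the error. At a jump the two halves of the even kernel produce the mean value `1/2`,
again up to the tail (`abs_stepFunction_sub_eval_le`). The gap `Δ_min` is a lower bound for all
the relevant distances; it is at most the angle of `b` because the largest singular value `‖A‖` has
angle `0`, and this keeps the mirrored jumps at negative angles away.

For the matrices, `v ↦ Q diag(v) Qᴴ` is an algebra homomorphism that maps the eigenvalues to `S_A`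
(`augmented_eq_conjDiagonal`). Hence `P_{S_A}` and `P` are the images of the values of the step
function and of the polynomial at the eigenvalues, which gives the norm bound and the
characteristic polynomial. The separation of the values of the polynomial follows from an error
below `1/4`, and the ordering from counting.
-/

namespace CJFeast

/-! ### Jackson factors -/

theorem sin_pi_div_pos (d : ℕ) : 0 < Real.sin (Real.pi / (d + 2)) := by
  have hd : (0 : ℝ) ≤ d := d.cast_nonneg
  apply Real.sin_pos_of_pos_of_lt_pi
  · positivity
  · exact div_lt_self Real.pi_pos (by linarith)

theorem jackson_one (d : ℕ) : jackson d 1 = Real.cos (Real.pi / (d + 2)) := by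
  have hs := (sin_pi_div_pos d).ne'
  have hd : (d : ℝ) + 2 ≠ 0 := by positivity
  unfold jackson
  push_cast
  rw [one_mul]
  field_simp
  ring

theorem jackson_two (d : ℕ) : jackson d 2 =
    Real.cos (2 * (Real.pi / (d + 2))) + 2 * Real.sin (Real.pi / (d + 2)) ^ 2 / (d + 2) := by
  have hs := (sin_pi_div_pos d).ne'
  have hd : (d : ℝ) + 2 ≠ 0 := by positivity
  unfold jackson
  push_cast
  rw [mul_div_assoc 2 Real.pi, Real.sin_two_mul, Real.cos_two_mul']
  set x := Real.pi / ((d : ℝ) + 2)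
  field_simp
  ring

theorem jackson_zero (d : ℕ) : jackson d 0 = 1 := by
  have hs := (sin_pi_div_pos d).ne'
  have hd : (d : ℝ) + 2 ≠ 0 := by positivity
  simp only [jackson, Nat.cast_zero, zero_mul, zero_div, Real.cos_zero, Real.sin_zero]
  rw [sub_zero, mul_one, mul_zero, add_zero]
  exact div_self (mul_ne_zero hd hs)

theorem jackson_succ_self (d : ℕ) : jackson d (d + 1) = 0 := by
  have hd : (d : ℝ) + 2 ≠ 0 := by positivity
  have h : ((d + 1 : ℕ) : ℝ) * Real.pi / (d + 2) = Real.pi - Real.pi / (d + 2) := by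
    push_cast; field_simp; ring
  unfold jackson
  rw [h, Real.cos_pi_sub, Real.sin_pi_sub]
  push_cast
  ring

theorem jackson_add_two_self (d : ℕ) : jackson d (d + 2) = 0 := by
  have hd : (d : ℝ) + 2 ≠ 0 := by positivity
  have h : ((d + 2 : ℕ) : ℝ) * Real.pi / (d + 2) = Real.pi := by
    push_cast; field_simp
  unfold jackson
  rw [h, Real.sin_pi]
  push_cast
  ring

/-- Closed form of the partial autocorrelations of `k ↦ sin (k x)`, obtained by telescoping. -/
theorem sum_sin_mul_sin_shift (x : ℝ) (j M : ℕ) :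
    2 * Real.sin x * ∑ k ∈ Finset.range M, Real.sin ((k + j : ℕ) * x) * Real.sin (k * x) =
      M * Real.sin x * Real.cos (j * x) -
        (Real.sin ((2 * M + j - 1) * x) - Real.sin ((j - 1) * x)) / 2 := by
  induction M with
  | zero => simp
  | succ M ih =>
    rw [Finset.sum_range_succ, mul_add, ih]
    have e1 : Real.sin ((2 * (M + 1 : ℕ) + j - 1) * x) =
        Real.sin ((M + j : ℕ) * x + M * x + x) := by push_cast; ring_nf
    have e2 : Real.sin ((2 * M + j - 1) * x) =
        Real.sin ((M + j : ℕ) * x + M * x - x) := by push_cast; ring_nf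
    have e3 : Real.cos (j * x) = Real.cos ((M + j : ℕ) * x - M * x) := by push_cast; ring_nf
    rw [e1, e2, e3, Real.sin_add _ x, Real.sin_sub _ x, Real.cos_sub, Real.cos_add]
    push_cast
    ring

/-- The Jackson factors are the normalized autocorrelations of the sequence
`sin (k π / (d + 2))`. -/
theorem jackson_eq_autocorrelation (d j : ℕ) (hj : j ≤ d + 2) :
    (d + 2) * jackson d j = 2 * ∑ k ∈ Finset.range (d + 2 - j),
      Real.sin ((k + j : ℕ) * (Real.pi / (d + 2))) * Real.sin (k * (Real.pi / (d + 2))) := by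
  have hs := (sin_pi_div_pos d).ne'
  have hd : (d : ℝ) + 2 ≠ 0 := by positivity
  have key := sum_sin_mul_sin_shift (Real.pi / (d + 2)) j (d + 2 - j)
  unfold jackson
  rw [mul_div_assoc (j : ℝ) Real.pi]
  have e : Real.sin ((2 * (d + 2 - j : ℕ) + j - 1) * (Real.pi / (d + 2))) =
      - Real.sin ((j + 1) * (Real.pi / (d + 2))) := by
    rw [← Real.sin_neg, ← Real.sin_add_two_pi (-_)]
    congr 1
    rw [Nat.cast_sub hj]; push_cast; field_simp; ring
  rw [e, Nat.cast_sub hj, sub_mul _ _ (Real.pi / _), add_mul _ _ (Real.pi / _), one_mul,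
    Real.sin_add, Real.sin_sub] at key
  push_cast at key ⊢
  set x := Real.pi / ((d : ℝ) + 2)
  rw [mul_div_assoc', mul_div_mul_left _ _ hd, div_eq_iff hs]
  linear_combination -key

/-- The squared modulus of a trigonometric polynomial in terms of its autocorrelations. -/
theorem sq_add_sq_eq_sum_autocorrelation (s : ℕ → ℝ) (t : ℝ) (M : ℕ) :
    (∑ k ∈ Finset.range M, s k * Real.cos (k * t)) ^ 2 +
        (∑ k ∈ Finset.range M, s k * Real.sin (k * t)) ^ 2 =
      2 * ∑ j ∈ Finset.range M, (∑ k ∈ Finset.range (M - j), s (k + j) * s k) * Real.cos (j * t) -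
        ∑ k ∈ Finset.range M, s k * s k := by
  have h := Finset.sum_range_diag_flip M (fun j k => s (k + j) * s k * Real.cos (j * t))
  simp_rw [Finset.sum_mul]
  rw [← h]
  clear h
  induction M with
  | zero => simp
  | succ M ih =>
    rw [Finset.sum_range_succ, Finset.sum_range_succ,
      Finset.sum_range_succ (fun m => ∑ k ∈ Finset.range (m + 1), _) M,
      Finset.sum_range_succ (fun k => s k * s k) M]
    have e : ∑ j ∈ Finset.range (M + 1), s (M - j + j) * s (M - j) * Real.cos (j * t) =
        s M * (∑ k ∈ Finset.range M, s k * Real.cos (k * t)) * Real.cos (M * t) +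
        s M * (∑ k ∈ Finset.range M, s k * Real.sin (k * t)) * Real.sin (M * t) + s M * s M := by
      rw [← Finset.sum_range_reflect, Finset.sum_range_succ, Finset.mul_sum, Finset.mul_sum,
        Finset.sum_mul, Finset.sum_mul, ← Finset.sum_add_distrib]
      congr 1
      · apply Finset.sum_congr rfl
        intro k hk
        have hk' := (Finset.mem_range.1 hk).le
        have h1 : M + 1 - 1 - k = M - k := by omega
        have h2 : M - (M - k) = k := by omega
        have h3 : k + (M - k) = M := by omega
        rw [h1, h2, h3, Nat.cast_sub hk', sub_mul, Real.cos_sub]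
        ring
      · simp
    rw [e]
    have := Real.sin_sq_add_cos_sq (M * t)
    linear_combination ih + s M ^ 2 * this

/-! ### The Jackson kernel and its positivity -/

/-- The Jackson kernel `1 + 2 ∑_{j ≤ d} ρ_{j,d} cos (j t)`. The sum is extended to `j = d + 1` and
`j = d + 2`, where the Jackson factors vanish, so that its Fourier coefficients of orders `1` and
`2` are `ρ_{1,d}` and `ρ_{2,d}` for every `d`. -/
noncomputable def jacksonKernel (d : ℕ) (t : ℝ) : ℝ :=
  1 + 2 * ∑ j ∈ Finset.range (d + 2), jackson d (j + 1) * Real.cos ((j + 1 : ℕ) * t)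

theorem jacksonKernel_eq_sum (d : ℕ) (t : ℝ) :
    jacksonKernel d t =
      1 + 2 * ∑ j ∈ Finset.range d, jackson d (j + 1) * Real.cos ((j + 1 : ℕ) * t) := by
  unfold jacksonKernel
  rw [Finset.sum_range_succ, Finset.sum_range_succ, jackson_succ_self, jackson_add_two_self]
  ring

theorem jacksonKernel_nonneg (d : ℕ) (t : ℝ) : 0 ≤ jacksonKernel d t := by
  have hd : (0 : ℝ) < (d : ℝ) + 2 := by positivity
  set s : ℕ → ℝ := fun k => Real.sin (k * (Real.pi / (d + 2)))
  have h := sq_add_sq_eq_sum_autocorrelation s t (d + 2)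
  have hr : ∀ j ≤ d + 2, ∑ k ∈ Finset.range (d + 2 - j), s (k + j) * s k =
      (d + 2) / 2 * jackson d j := by
    intro j hj
    linear_combination -(1 / 2) * jackson_eq_autocorrelation d j hj
  have h0 : ∑ k ∈ Finset.range (d + 2), s k * s k = (d + 2) / 2 := by
    have := hr 0 (by omega)
    rw [jackson_zero] at this
    simpa using this
  have hsum : ∑ j ∈ Finset.range (d + 2),
      (∑ k ∈ Finset.range (d + 2 - j), s (k + j) * s k) * Real.cos (j * t) =
      (d + 2) / 2 * ∑ j ∈ Finset.range (d + 2), jackson d j * Real.cos (j * t) := by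
    rw [Finset.mul_sum]
    refine Finset.sum_congr rfl fun j hj => ?_
    rw [hr j (Finset.mem_range.1 hj).le, mul_assoc]
  rw [h0, hsum, Finset.sum_range_succ' (fun j => jackson d j * Real.cos (j * t)),
    Finset.sum_range_succ (fun j => jackson d (j + 1) * Real.cos ((j + 1 : ℕ) * t)),
    jackson_succ_self, jackson_zero, Nat.cast_zero, zero_mul t, Real.cos_zero] at h
  have e : (d + 2) * jacksonKernel d t =
      2 * ((∑ k ∈ Finset.range (d + 2), s k * Real.cos (k * t)) ^ 2 +
        (∑ k ∈ Finset.range (d + 2), s k * Real.sin (k * t)) ^ 2) := by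
    rw [h, jacksonKernel_eq_sum]
    ring
  have : 0 ≤ (d + 2) * jacksonKernel d t := by rw [e]; positivity
  exact nonneg_of_mul_nonneg_right this hd

/-! ### Moments and tails of the Jackson kernel -/

theorem continuous_jacksonKernel (d : ℕ) : Continuous (jacksonKernel d) := by
  unfold jacksonKernel
  fun_prop

theorem jacksonKernel_neg (d : ℕ) (t : ℝ) : jacksonKernel d (-t) = jacksonKernel d t := by
  simp [jacksonKernel]

theorem jacksonKernel_periodic (d : ℕ) : Function.Periodic (jacksonKernel d) (2 * Real.pi) := by
  intro t
  simp only [jacksonKernel, mul_add, Real.cos_add_nat_mul_two_pi]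

theorem intervalIntegrable_jacksonKernel (d : ℕ) (p q : ℝ) :
    IntervalIntegrable (jacksonKernel d) MeasureTheory.volume p q :=
  (continuous_jacksonKernel d).intervalIntegrable p q

theorem integral_cos_int_mul (k : ℤ) (hk : k ≠ 0) :
    ∫ t in (0 : ℝ)..2 * Real.pi, Real.cos (k * t) = 0 := by
  have hk' : (k : ℝ) ≠ 0 := by exact_mod_cast hk
  rw [intervalIntegral.integral_comp_mul_left _ hk', integral_cos, mul_zero, Real.sin_zero]
  rw [← zero_add ((k : ℝ) * (2 * Real.pi)), Real.sin_add_int_mul_two_pi, Real.sin_zero, sub_zero,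
    smul_zero]

theorem integral_cos_mul_cos (j k : ℕ) (hk : k ≠ 0) :
    ∫ t in (0 : ℝ)..2 * Real.pi, Real.cos (j * t) * Real.cos (k * t) =
      if j = k then Real.pi else 0 := by
  have e : ∀ t : ℝ, Real.cos (j * t) * Real.cos (k * t) =
      (Real.cos (((j - k : ℤ) : ℝ) * t) + Real.cos (((j + k : ℤ) : ℝ) * t)) / 2 := by
    intro t
    push_cast
    rw [sub_mul, add_mul, Real.cos_sub, Real.cos_add]
    ring
  simp_rw [e]
  rw [intervalIntegral.integral_div, intervalIntegral.integral_add
    (Continuous.intervalIntegrable (by fun_prop) _ _)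
    (Continuous.intervalIntegrable (by fun_prop) _ _), integral_cos_int_mul (j + k) (by omega)]
  split_ifs with h
  · subst h; simp
  · rw [integral_cos_int_mul _ (by omega)]; simp

theorem integral_jacksonKernel_mul_cos (d k : ℕ) (hk : k ≠ 0) (hkd : k ≤ d + 2) :
    ∫ t in (0 : ℝ)..2 * Real.pi, jacksonKernel d t * Real.cos (k * t) =
      2 * Real.pi * jackson d k := by
  have e : ∀ t : ℝ, jacksonKernel d t * Real.cos (k * t) = Real.cos ((k : ℤ) * t) +
      ∑ j ∈ Finset.range (d + 2),
        2 * jackson d (j + 1) * (Real.cos ((j + 1 : ℕ) * t) * Real.cos (k * t)) := by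
    intro t
    simp_rw [jacksonKernel, add_mul, mul_assoc, ← Finset.mul_sum, Finset.sum_mul, mul_assoc]
    simp
  simp_rw [e]
  rw [intervalIntegral.integral_add (Continuous.intervalIntegrable (by fun_prop) _ _)
    (Continuous.intervalIntegrable (by fun_prop) _ _), integral_cos_int_mul _ (by omega),
    intervalIntegral.integral_finsetSum
      (fun j _ => Continuous.intervalIntegrable (by fun_prop) _ _)]
  simp_rw [intervalIntegral.integral_const_mul, integral_cos_mul_cos _ k hk]
  obtain ⟨k, rfl⟩ := Nat.exists_eq_succ_of_ne_zero hk
  simp [show k < d + 2 by omega]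
  ring

theorem integral_jacksonKernel (d : ℕ) :
    ∫ t in (0 : ℝ)..2 * Real.pi, jacksonKernel d t = 2 * Real.pi := by
  unfold jacksonKernel
  rw [intervalIntegral.integral_add (Continuous.intervalIntegrable (by fun_prop) _ _)
    (Continuous.intervalIntegrable (by fun_prop) _ _), intervalIntegral.integral_const_mul,
    intervalIntegral.integral_finsetSum
      (fun j _ => Continuous.intervalIntegrable (by fun_prop) _ _), Finset.sum_eq_zero]
  · simp
  · intro j _
    rw [intervalIntegral.integral_const_mul]
    have := integral_cos_int_mul ((j + 1 : ℕ) : ℤ) (by omega)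
    simp only [Int.cast_natCast] at this
    rw [this, mul_zero]

theorem integral_jacksonKernel_zero_pi (d : ℕ) :
    ∫ t in (0 : ℝ)..Real.pi, jacksonKernel d t = Real.pi := by
  have h := integral_jacksonKernel d
  have h2 : ∫ t in Real.pi..2 * Real.pi, jacksonKernel d t =
      ∫ t in (0 : ℝ)..Real.pi, jacksonKernel d t := by
    have := intervalIntegral.integral_comp_sub_left (a := 0) (b := Real.pi)
      (jacksonKernel d) (2 * Real.pi)
    rw [sub_zero, show 2 * Real.pi - Real.pi = Real.pi by ring] at this
    rw [← this]
    congr 1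
    ext t
    rw [(jacksonKernel_periodic d).sub_eq', jacksonKernel_neg]
  rw [← intervalIntegral.integral_add_adjacent_intervals
    (intervalIntegrable_jacksonKernel d 0 Real.pi) (intervalIntegrable_jacksonKernel d _ _),
    h2] at h
  linarith

theorem integral_jacksonKernel_mul_one_sub_cos_sq (d : ℕ) :
    ∫ t in (0 : ℝ)..2 * Real.pi, jacksonKernel d t * (1 - Real.cos t) ^ 2 =
      2 * Real.pi * ((1 - Real.cos (Real.pi / (d + 2))) ^ 2 +
        Real.sin (Real.pi / (d + 2)) ^ 2 / (d + 2)) := by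
  have hJ := continuous_jacksonKernel d
  have e : ∀ t : ℝ, jacksonKernel d t * (1 - Real.cos t) ^ 2 = 3 / 2 * jacksonKernel d t -
      2 * (jacksonKernel d t * Real.cos ((1 : ℕ) * t)) +
      1 / 2 * (jacksonKernel d t * Real.cos ((2 : ℕ) * t)) := by
    intro t
    push_cast
    rw [one_mul, Real.cos_two_mul]
    ring
  simp_rw [e]
  rw [intervalIntegral.integral_add (Continuous.intervalIntegrable (by fun_prop) _ _)
    (Continuous.intervalIntegrable (by fun_prop) _ _),
    intervalIntegral.integral_sub (Continuous.intervalIntegrable (by fun_prop) _ _)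
    (Continuous.intervalIntegrable (by fun_prop) _ _), intervalIntegral.integral_const_mul,
    intervalIntegral.integral_const_mul, intervalIntegral.integral_const_mul,
    integral_jacksonKernel, integral_jacksonKernel_mul_cos d 1 (by omega) (by omega),
    integral_jacksonKernel_mul_cos d 2 (by omega) (by omega), jackson_one, jackson_two,
    Real.cos_two_mul]
  ring

/-- The second moment of the kernel with respect to `1 - cos t`, divided by `2π`, is `O(d⁻³)`. -/
theorem one_sub_cos_sq_add_le (d : ℕ) :
    (1 - Real.cos (Real.pi / (d + 2))) ^ 2 + Real.sin (Real.pi / (d + 2)) ^ 2 / (d + 2) ≤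
      2 * Real.pi ^ 2 / ((d : ℝ) + 2) ^ 3 := by
  have hN : (0 : ℝ) < (d : ℝ) + 2 := by positivity
  have hx : 0 < Real.pi / ((d : ℝ) + 2) := by positivity
  have h2 : Real.sin (Real.pi / (d + 2)) ^ 2 / (d + 2) ≤ Real.pi ^ 2 / ((d : ℝ) + 2) ^ 3 := by
    have : Real.sin (Real.pi / (d + 2)) ^ 2 ≤ (Real.pi / (d + 2)) ^ 2 :=
      pow_le_pow_left₀ (sin_pi_div_pos d).le (Real.sin_lt hx).le 2
    calc _ ≤ (Real.pi / (d + 2)) ^ 2 / ((d : ℝ) + 2) := by gcongr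
      _ = _ := by field_simp
  have h1 : (1 - Real.cos (Real.pi / (d + 2))) ^ 2 ≤ Real.pi ^ 2 / ((d : ℝ) + 2) ^ 3 := by
    rcases Nat.eq_zero_or_pos d with rfl | hd
    · -- here `π² > 4 (d + 2)`, and the general estimate below fails
      norm_num
      nlinarith [Real.pi_gt_three]
    · have hc : 1 - Real.cos (Real.pi / (d + 2)) ≤ (Real.pi / (d + 2)) ^ 2 / 2 := by
        linarith [Real.one_sub_sq_div_two_le_cos (x := Real.pi / (d + 2))]
      have hd1 : (1 : ℝ) ≤ d := by exact_mod_cast hd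
      have hpi : Real.pi ^ 2 ≤ 4 * ((d : ℝ) + 2) := by
        nlinarith [Real.pi_lt_d2, Real.pi_pos]
      calc _ ≤ ((Real.pi / (d + 2)) ^ 2 / 2) ^ 2 :=
            pow_le_pow_left₀ (by linarith [Real.cos_le_one (Real.pi / (d + 2))]) hc 2
        _ = Real.pi ^ 2 * Real.pi ^ 2 / (4 * ((d : ℝ) + 2) ^ 4) := by field_simp; norm_num
        _ ≤ Real.pi ^ 2 * (4 * ((d : ℝ) + 2)) / (4 * ((d : ℝ) + 2) ^ 4) := by gcongr
        _ = _ := by field_simp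
  calc _ ≤ Real.pi ^ 2 / ((d : ℝ) + 2) ^ 3 + Real.pi ^ 2 / ((d : ℝ) + 2) ^ 3 := add_le_add h1 h2
    _ = _ := by ring

theorem integral_jacksonKernel_mono {d : ℕ} {p q p' q' : ℝ} (hp : p' ≤ p) (hpq : p ≤ q)
    (hq : q ≤ q') : ∫ t in p..q, jacksonKernel d t ≤ ∫ t in p'..q', jacksonKernel d t :=
  intervalIntegral.integral_mono_interval hp hpq hq
    (Filter.Eventually.of_forall (jacksonKernel_nonneg d)) (intervalIntegrable_jacksonKernel d _ _)

/-- The error bound `π⁶ / (2 (d + 2)³ Δ⁴)`. -/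
noncomputable def errorBound (d : ℕ) (Δ : ℝ) : ℝ :=
  Real.pi ^ 6 / (2 * ((d : ℝ) + 2) ^ 3 * Δ ^ 4)

/-- A Chebyshev-type inequality: away from the multiples of `2π`, where
`1 - cos t ≥ 2 Δ² / π²`, the mass of the kernel is controlled by its second moment. -/
theorem integral_jacksonKernel_tail_le (d : ℕ) {Δ : ℝ} (hΔ : 0 < Δ) (hΔ' : Δ ≤ Real.pi) :
    ∫ t in Δ..2 * Real.pi - Δ, jacksonKernel d t ≤ 2 * Real.pi * errorBound d Δ := by
  have hJ := continuous_jacksonKernel d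
  have hpi := Real.pi_pos
  have hcos : ∀ t ∈ Set.Icc Δ (2 * Real.pi - Δ), 2 / Real.pi ^ 2 * Δ ^ 2 ≤ 1 - Real.cos t := by
    intro t ht
    have h1 : Real.cos Δ ≤ 1 - 2 / Real.pi ^ 2 * Δ ^ 2 :=
      Real.cos_le_one_sub_mul_cos_sq (by rwa [abs_of_pos hΔ])
    have h2 : Real.cos t ≤ Real.cos Δ := by
      rcases le_total t Real.pi with h | h
      · exact Real.cos_le_cos_of_nonneg_of_le_pi hΔ.le h ht.1
      · rw [← Real.cos_two_pi_sub t]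
        exact Real.cos_le_cos_of_nonneg_of_le_pi hΔ.le (by linarith) (by linarith [ht.2])
    linarith
  have hC : 0 < 2 / Real.pi ^ 2 * Δ ^ 2 := by positivity
  calc ∫ t in Δ..2 * Real.pi - Δ, jacksonKernel d t
      ≤ ∫ t in Δ..2 * Real.pi - Δ,
          ((2 / Real.pi ^ 2 * Δ ^ 2) ^ 2)⁻¹ * (jacksonKernel d t * (1 - Real.cos t) ^ 2) := by
        apply intervalIntegral.integral_mono_on (by linarith)
          (Continuous.intervalIntegrable (by fun_prop) _ _)
          (Continuous.intervalIntegrable (by fun_prop) _ _)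
        intro t ht
        rw [inv_mul_eq_div, le_div_iff₀ (by positivity)]
        exact mul_le_mul_of_nonneg_left (pow_le_pow_left₀ hC.le (hcos t ht) 2)
          (jacksonKernel_nonneg d t)
    _ = ((2 / Real.pi ^ 2 * Δ ^ 2) ^ 2)⁻¹ *
          ∫ t in Δ..2 * Real.pi - Δ, jacksonKernel d t * (1 - Real.cos t) ^ 2 :=
        intervalIntegral.integral_const_mul _ _
    _ ≤ ((2 / Real.pi ^ 2 * Δ ^ 2) ^ 2)⁻¹ *
          ∫ t in (0 : ℝ)..2 * Real.pi, jacksonKernel d t * (1 - Real.cos t) ^ 2 := by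
        gcongr
        apply intervalIntegral.integral_mono_interval hΔ.le (by linarith) (by linarith)
        · exact Filter.Eventually.of_forall
            (fun t => mul_nonneg (jacksonKernel_nonneg d t) (sq_nonneg _))
        · exact Continuous.intervalIntegrable (by fun_prop) _ _
    _ ≤ ((2 / Real.pi ^ 2 * Δ ^ 2) ^ 2)⁻¹ *
          (2 * Real.pi * (2 * Real.pi ^ 2 / ((d : ℝ) + 2) ^ 3)) := by
        rw [integral_jacksonKernel_mul_one_sub_cos_sq]
        gcongr
        exact one_sub_cos_sq_add_le d
    _ = _ := by
        unfold errorBound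
        field_simp

theorem integral_jacksonKernel_le_of_subset (d : ℕ) {Δ p q : ℝ} (hΔ : 0 < Δ) (hp : Δ ≤ p)
    (hpq : p ≤ q) (hq : q ≤ 2 * Real.pi - Δ) :
    ∫ t in p..q, jacksonKernel d t ≤ 2 * Real.pi * errorBound d Δ :=
  (integral_jacksonKernel_mono hp hpq hq).trans
    (integral_jacksonKernel_tail_le d hΔ (by linarith))

/-! ### The Chebyshev–Jackson polynomial as a convolution -/

theorem integral_jacksonKernel_period (d : ℕ) (p : ℝ) :
    ∫ t in p..p + 2 * Real.pi, jacksonKernel d t = 2 * Real.pi := by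
  rw [(jacksonKernel_periodic d).intervalIntegral_add_eq p 0, zero_add, integral_jacksonKernel]

theorem integral_jacksonKernel_add_two_pi (d : ℕ) (p q : ℝ) :
    ∫ t in p + 2 * Real.pi..q + 2 * Real.pi, jacksonKernel d t =
      ∫ t in p..q, jacksonKernel d t := by
  rw [← intervalIntegral.integral_comp_add_right]
  congr 1
  ext t
  exact jacksonKernel_periodic d t

theorem integral_jacksonKernel_neg (d : ℕ) (p q : ℝ) :
    ∫ t in -q..-p, jacksonKernel d t = ∫ t in p..q, jacksonKernel d t := by
  rw [← intervalIntegral.integral_comp_neg]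
  congr 1
  ext t
  exact jacksonKernel_neg d t

/-- The Chebyshev–Jackson polynomial is the convolution of the Jackson kernel with the step
function, transplanted to the circle by `x = cos θ`. -/
theorem eval_chebJackson_cos (a b θ : ℝ) (d : ℕ) :
    2 * Real.pi * (chebJackson a b d).eval (Real.cos θ) =
      (∫ t in θ - Real.arccos a..θ - Real.arccos b, jacksonKernel d t) +
        ∫ t in θ + Real.arccos b..θ + Real.arccos a, jacksonKernel d t := by
  have hJ := continuous_jacksonKernel d
  have hpi := Real.pi_ne_zero
  set α := Real.arccos a with hα
  set β := Real.arccos b with hβ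
  rw [← intervalIntegral.integral_comp_sub_left, ← intervalIntegral.integral_comp_add_left,
    ← intervalIntegral.integral_add (Continuous.intervalIntegrable (by fun_prop) _ _)
      (Continuous.intervalIntegrable (by fun_prop) _ _)]
  have e : ∀ t : ℝ, jacksonKernel d (θ - t) + jacksonKernel d (θ + t) =
      2 + ∑ j ∈ Finset.range d,
        4 * jackson d (j + 1) * Real.cos ((j + 1 : ℕ) * θ) * Real.cos ((j + 1 : ℕ) * t) := by
    intro t
    simp_rw [jacksonKernel_eq_sum, mul_sub, mul_add, Real.cos_add, Real.cos_sub]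
    rw [show ∀ x y : ℝ, 1 + 2 * x + (1 + 2 * y) = 2 + (2 * x + 2 * y) by intros; ring,
      Finset.mul_sum, Finset.mul_sum, ← Finset.sum_add_distrib]
    congr 1
    apply Finset.sum_congr rfl
    intro j _
    ring
  simp_rw [e]
  rw [intervalIntegral.integral_add (Continuous.intervalIntegrable (by fun_prop) _ _)
    (Continuous.intervalIntegrable (by fun_prop) _ _),
    intervalIntegral.integral_finsetSum
      (fun j _ => Continuous.intervalIntegrable (by fun_prop) _ _)]
  simp_rw [intervalIntegral.integral_const_mul]
  have ec : ∀ j : ℕ, ∫ t in β..α, Real.cos ((j + 1 : ℕ) * t) =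
      (Real.sin ((j + 1 : ℕ) * α) - Real.sin ((j + 1 : ℕ) * β)) / (j + 1 : ℕ) := by
    intro j
    rw [intervalIntegral.integral_comp_mul_left _ (by positivity), integral_cos, smul_eq_mul,
      inv_mul_eq_div]
  simp_rw [ec]
  unfold chebJackson
  rw [Polynomial.eval_finsetSum, Finset.sum_range_succ']
  simp only [Polynomial.eval_mul, Polynomial.eval_C, Polynomial.Chebyshev.T_real_cos, chebCoeff,
    jackson_zero, ← hα, ← hβ, Nat.succ_ne_zero, if_false, if_true]
  rw [mul_add, Finset.mul_sum, add_comm]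
  congr 1
  · simp
    field_simp
  · apply Finset.sum_congr rfl
    intro j _
    push_cast
    field_simp
    ring

theorem errorBound_nonneg (d : ℕ) (Δ : ℝ) : 0 ≤ errorBound d Δ := by
  unfold errorBound; positivity

/-! ### Pointwise error for the step function -/

/-- The step function of `[a, b]`, with the mean value `1 / 2` at its two jumps. -/
noncomputable def stepFunction (a b x : ℝ) : ℝ :=
  if a < x ∧ x < b then 1 else if x = a ∨ x = b then 1 / 2 else 0

theorem integral_jacksonKernel_nonneg (d : ℕ) {p q : ℝ} (h : p ≤ q) :
    0 ≤ ∫ t in p..q, jacksonKernel d t :=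
  intervalIntegral.integral_nonneg h fun t _ => jacksonKernel_nonneg d t

theorem integral_jacksonKernel_add (d : ℕ) (p q s : ℝ) :
    (∫ t in p..q, jacksonKernel d t) + ∫ t in q..s, jacksonKernel d t =
      ∫ t in p..s, jacksonKernel d t :=
  intervalIntegral.integral_add_adjacent_intervals (intervalIntegrable_jacksonKernel d _ _)
    (intervalIntegrable_jacksonKernel d _ _)

/-- The two intervals of integration are disjoint parts of one period of the kernel. -/
theorem eval_chebJackson_mem_Icc {a b x : ℝ} (hab : a ≤ b) (hx : x ∈ Set.Icc (-1 : ℝ) 1) (d : ℕ) :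
    (chebJackson a b d).eval x ∈ Set.Icc (0 : ℝ) 1 := by
  have h := eval_chebJackson_cos a b (Real.arccos x) d
  rw [Real.cos_arccos hx.1 hx.2] at h
  have hαβ : Real.arccos b ≤ Real.arccos a := Real.arccos_le_arccos hab
  have hβ := Real.arccos_nonneg b
  have hα := Real.arccos_le_pi a
  have hpi := Real.pi_pos
  set α := Real.arccos a
  set β := Real.arccos b
  set θ := Real.arccos x
  have h1 := integral_jacksonKernel_nonneg d (p := θ - α) (q := θ - β) (by linarith)
  have h2 := integral_jacksonKernel_nonneg d (p := θ - β) (q := θ + β) (by linarith)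
  have h3 := integral_jacksonKernel_nonneg d (p := θ + β) (q := θ + α) (by linarith)
  have h4 := integral_jacksonKernel_nonneg d (p := θ + α) (q := θ - α + 2 * Real.pi) (by linarith)
  have h5 := integral_jacksonKernel_period d (θ - α)
  rw [← integral_jacksonKernel_add d _ (θ + α), ← integral_jacksonKernel_add d _ (θ + β),
    ← integral_jacksonKernel_add d _ (θ - β)] at h5
  constructor
  · exact nonneg_of_mul_nonneg_right (by linarith) (by positivity : 0 < 2 * Real.pi)
  · exact le_of_mul_le_mul_left (by linarith) (by positivity : 0 < 2 * Real.pi)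

/-- The approximation error at a point whose angle is at distance at least `Δ` from those of the
jumps of the step function other than the point itself. Since `0 < a`, the angles of the jumps
lie in `(0, π/2)`, and `Δ ≤ arccos b` keeps the point away from the mirrored jumps
`-arccos a` and `-arccos b`. At a jump, the two halves of the kernel cancel up to the distance
of the next jump. -/
theorem abs_stepFunction_sub_eval_le {a b x Δ : ℝ} (ha : 0 < a) (hab : a < b) (hb : b < 1)
    (hx : x ∈ Set.Icc (-1 : ℝ) 1) (hΔ : 0 < Δ) (hΔb : Δ ≤ Real.arccos b)
    (hxa : x ≠ a → Δ ≤ |Real.arccos x - Real.arccos a|)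
    (hxb : x ≠ b → Δ ≤ |Real.arccos x - Real.arccos b|) (d : ℕ) :
    |stepFunction a b x - (chebJackson a b d).eval x| ≤ errorBound d Δ := by
  have h := eval_chebJackson_cos a b (Real.arccos x) d
  rw [Real.cos_arccos hx.1 hx.2] at h
  have hαβ : Real.arccos b < Real.arccos a :=
    Real.arccos_lt_arccos (by linarith) hab hb.le
  have hα : Real.arccos a < Real.pi / 2 := Real.arccos_lt_pi_div_two.2 ha
  have hθ0 := Real.arccos_nonneg x
  have hθ1 := Real.arccos_le_pi x
  have hpi := Real.pi_pos
  have hlt : ∀ {u v : ℝ}, u < v → -1 ≤ u → v ≤ 1 → Real.arccos v < Real.arccos u :=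
    fun h h1 h2 => Real.arccos_lt_arccos h1 h h2
  have hpos : 0 < 2 * Real.pi := by positivity
  suffices hs : 2 * Real.pi * (stepFunction a b x - (chebJackson a b d).eval x) ≤
      2 * Real.pi * errorBound d Δ ∧ -(2 * Real.pi * errorBound d Δ) ≤
      2 * Real.pi * (stepFunction a b x - (chebJackson a b d).eval x) by
    rw [abs_le]
    exact ⟨le_of_mul_le_mul_left (by linarith [hs.2]) hpos, le_of_mul_le_mul_left hs.1 hpos⟩
  rw [mul_sub, h]
  clear h
  have hE : 0 ≤ 2 * Real.pi * errorBound d Δ := mul_nonneg hpos.le (errorBound_nonneg d Δ)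
  have hsub := fun p q => integral_jacksonKernel_le_of_subset d (p := p) (q := q) hΔ
  have hnn := fun p q => integral_jacksonKernel_nonneg d (p := p) (q := q)
  have hadd := integral_jacksonKernel_add d
  rcases lt_trichotomy x a with hlt' | rfl | hgt
  · -- left of the interval: both intervals of integration avoid the peak
    have hθ := hlt hlt' hx.1 (by linarith)
    have h1 := hxa hlt'.ne
    rw [abs_of_pos (by linarith)] at h1
    rw [stepFunction, if_neg (by intro h; linarith [h.1]),
      if_neg (by rintro (h | h) <;> linarith)]
    set α := Real.arccos a
    set β := Real.arccos b
    set θ := Real.arccos x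
    have e1 := hadd (θ - α) (θ - β) (θ + β)
    have e2 := hadd (θ - α) (θ + β) (θ + α)
    have k0 := hsub (θ - α) (θ + α) (by linarith) (by linarith) (by linarith)
    have k1 := hnn (θ - α) (θ - β) (by linarith)
    have k2 := hnn (θ - β) (θ + β) (by linarith)
    have k3 := hnn (θ + β) (θ + α) (by linarith)
    constructor <;> linarith
  · -- the left jump
    have h1 := hxb hab.ne
    rw [abs_of_pos (by linarith)] at h1
    rw [stepFunction, if_neg (by simp), if_pos (Or.inl rfl), sub_self]
    set α := Real.arccos x
    set β := Real.arccos b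
    have e1 := hadd 0 (α - β) Real.pi
    rw [integral_jacksonKernel_zero_pi] at e1
    have k1 := hsub (α - β) Real.pi h1 (by linarith) (by linarith)
    have k2 := hsub (α + β) (α + α) (by linarith) (by linarith) (by linarith)
    have k3 := hnn (α - β) Real.pi (by linarith)
    have k4 := hnn (α + β) (α + α) (by linarith)
    constructor <;> linarith
  · rcases lt_trichotomy x b with hlt' | rfl | hgt'
    · -- inside the interval: the complementary intervals avoid the peak
      have hθa := hlt hgt (by linarith) hx.2
      have hθb := hlt hlt' hx.1 (by linarith)
      have h1 := hxa hgt.ne'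
      have h2 := hxb hlt'.ne
      rw [abs_of_neg (by linarith)] at h1
      rw [abs_of_pos (by linarith)] at h2
      rw [stepFunction, if_pos ⟨hgt, hlt'⟩]
      set α := Real.arccos a
      set β := Real.arccos b
      set θ := Real.arccos x
      have h5 := integral_jacksonKernel_period d (θ - α)
      have e1 := hadd (θ - α) (θ - β) (θ + β)
      have e2 := hadd (θ - α) (θ + β) (θ + α)
      have e3 := hadd (θ - α) (θ + α) (θ - α + 2 * Real.pi)
      have e4 := hadd (θ - β) (θ + β) (θ + α)
      have e5 := hadd (θ - β) (θ + α) (θ - α + 2 * Real.pi)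
      have k0 := hsub (θ - β) (θ - α + 2 * Real.pi) (by linarith) (by linarith) (by linarith)
      have k2 := hnn (θ - β) (θ + β) (by linarith)
      have k3 := hnn (θ + β) (θ + α) (by linarith)
      have k4 := hnn (θ + α) (θ - α + 2 * Real.pi) (by linarith)
      constructor <;> linarith
    · -- the right jump
      have h1 := hxa hgt.ne'
      rw [abs_of_neg (by linarith)] at h1
      rw [stepFunction, if_neg (by simp), if_pos (Or.inr rfl), sub_self]
      set α := Real.arccos a
      set β := Real.arccos x
      have e0 := integral_jacksonKernel_neg d 0 (α - β)
      rw [neg_zero, neg_sub] at e0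
      have e1 := hadd 0 (α - β) Real.pi
      rw [integral_jacksonKernel_zero_pi] at e1
      have k1 := hsub (α - β) Real.pi (by linarith) (by linarith) (by linarith)
      have k2 := hsub (β + β) (β + α) (by linarith) (by linarith) (by linarith)
      have k3 := hnn (α - β) Real.pi (by linarith)
      have k4 := hnn (β + β) (β + α) (by linarith)
      constructor <;> linarith
    · -- right of the interval: the first interval is shifted by a period
      have hθ := hlt hgt' (by linarith) hx.2
      have h1 := hxb hgt'.ne'
      rw [abs_of_neg (by linarith)] at h1
      rw [stepFunction, if_neg (by intro h; linarith [h.2]),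
        if_neg (by rintro (h | h) <;> linarith)]
      set α := Real.arccos a
      set β := Real.arccos b
      set θ := Real.arccos x
      rw [← integral_jacksonKernel_add_two_pi d (θ - α)]
      have e1 := hadd (θ + β) (θ + α) (θ - α + 2 * Real.pi)
      have e2 := hadd (θ + β) (θ - α + 2 * Real.pi) (θ - β + 2 * Real.pi)
      have k0 := hsub (θ + β) (θ - β + 2 * Real.pi) (by linarith) (by linarith) (by linarith)
      have k1 := hnn (θ - α + 2 * Real.pi) (θ - β + 2 * Real.pi) (by linarith)
      have k2 := hnn (θ + α) (θ - α + 2 * Real.pi) (by linarith)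
      have k3 := hnn (θ + β) (θ + α) (by linarith)
      constructor <;> linarith

/-! ### Functions of a unitarily diagonalized matrix -/

section Spectral

variable {𝕜 ι κ : Type*} [RCLike 𝕜] [Fintype ι] [DecidableEq ι] [Fintype κ] [DecidableEq κ]

/-- For a matrix `Q` with `Qᴴ Q = 1` and `Q Qᴴ = 1`, whose rows and columns may be indexed by
different types, the algebra homomorphism `v ↦ Q diag(v) Qᴴ`. -/
noncomputable def conjDiagonal (Q : Matrix κ ι 𝕜) (h₁ : Qᴴ * Q = 1) (h₂ : Q * Qᴴ = 1) :
    (ι → ℝ) →ₐ[ℝ] Matrix κ κ 𝕜 where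
  toFun v := Q * Matrix.diagonal (fun i => (v i : 𝕜)) * Qᴴ
  map_one' := by simp [h₂]
  map_zero' := by simp
  map_add' v w := by
    rw [← Matrix.add_mul, ← Matrix.mul_add, Matrix.diagonal_add]
    simp
  map_mul' v w := by
    rw [show Q * Matrix.diagonal (fun i => (v i : 𝕜)) * Qᴴ *
        (Q * Matrix.diagonal (fun i => (w i : 𝕜)) * Qᴴ) =
        Q * Matrix.diagonal (fun i => (v i : 𝕜)) * (Qᴴ * Q) *
          Matrix.diagonal (fun i => (w i : 𝕜)) * Qᴴ by simp only [Matrix.mul_assoc], h₁,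
      Matrix.mul_one, Matrix.mul_assoc Q (Matrix.diagonal _) (Matrix.diagonal _),
      Matrix.diagonal_mul_diagonal]
    simp
  commutes' r := by
    have : (Matrix.diagonal (fun _ => (r : 𝕜)) : Matrix ι ι 𝕜) = r • 1 := by
      ext i j
      simp [Matrix.diagonal_apply, Matrix.one_apply, RCLike.real_smul_eq_coe_mul]
    simp only [Pi.algebraMap_apply, Algebra.algebraMap_self, RingHom.id_apply]
    rw [this, Matrix.mul_smul, Matrix.smul_mul, Matrix.mul_one, h₂,
      Algebra.algebraMap_eq_smul_one]

theorem conjDiagonal_apply (Q : Matrix κ ι 𝕜) (h₁ : Qᴴ * Q = 1) (h₂ : Q * Qᴴ = 1) (v : ι → ℝ) :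
    conjDiagonal Q h₁ h₂ v = Q * Matrix.diagonal (fun i => (v i : 𝕜)) * Qᴴ := rfl

theorem norm_conjDiagonal_le (Q : Matrix κ ι 𝕜) (h₁ : Qᴴ * Q = 1) (h₂ : Q * Qᴴ = 1) (v : ι → ℝ)
    {E : ℝ} (hE : 0 ≤ E) (hv : ∀ i, |v i| ≤ E) : ‖conjDiagonal Q h₁ h₂ v‖ ≤ E := by
  have hQ : ‖Q‖ ≤ 1 := by
    have h := Matrix.l2_opNorm_conjTranspose_mul_self Q
    have h1 : ‖(1 : Matrix ι ι 𝕜)‖ ≤ 1 := by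
      rw [← Matrix.diagonal_one, Matrix.l2_opNorm_diagonal]
      exact (pi_norm_le_iff_of_nonneg zero_le_one).2 fun i => by simp
    rw [h₁] at h
    nlinarith [norm_nonneg Q]
  have hD : ‖Matrix.diagonal (fun i => (v i : 𝕜))‖ ≤ E := by
    rw [Matrix.l2_opNorm_diagonal]
    exact (pi_norm_le_iff_of_nonneg hE).2 fun i => by simpa using hv i
  rw [conjDiagonal_apply]
  calc _ ≤ ‖Q‖ * ‖Matrix.diagonal (fun i => (v i : 𝕜))‖ * ‖Qᴴ‖ :=
        (Matrix.l2_opNorm_mul _ _).trans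
          (mul_le_mul_of_nonneg_right (Matrix.l2_opNorm_mul _ _) (norm_nonneg _))
    _ ≤ 1 * E * 1 := by
        rw [Matrix.l2_opNorm_conjTranspose]
        gcongr
    _ = E := by ring

theorem charpoly_conjDiagonal (Q : Matrix κ ι 𝕜) (h₁ : Qᴴ * Q = 1) (h₂ : Q * Qᴴ = 1)
    (hcard : Fintype.card ι = Fintype.card κ) (v : ι → ℝ) :
    (conjDiagonal Q h₁ h₂ v).charpoly = ∏ i, (Polynomial.X - Polynomial.C (v i : 𝕜)) := by
  rw [conjDiagonal_apply, Matrix.mul_assoc, Matrix.charpoly_mul_comm_of_le _ _ hcard.le,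
    Matrix.mul_assoc, h₁, Matrix.mul_one, Matrix.charpoly_diagonal, hcard]
  simp

end Spectral

/-! ### Eigendecomposition of the augmented matrix -/

section SVD

variable {𝕜 : Type*} [RCLike 𝕜] {m n : ℕ} {A : Matrix (Fin m) (Fin n) 𝕜}
  {U : Matrix (Fin m) (Fin m) 𝕜} {σ : Fin n → ℝ} {V : Matrix (Fin n) (Fin n) 𝕜}

theorem IsSVD.conjTranspose_mul_self_left (h : IsSVD A U σ V) : Uᴴ * U = 1 :=
  Matrix.mem_unitaryGroup_iff'.1 h.left_unitary

theorem IsSVD.conjTranspose_mul_self_right (h : IsSVD A U σ V) : Vᴴ * V = 1 :=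
  Matrix.mem_unitaryGroup_iff'.1 h.right_unitary

theorem leftCols_conjTranspose_mul_self (hmn : n ≤ m) (hU : Uᴴ * U = 1) :
    (leftCols hmn U)ᴴ * leftCols hmn U = 1 := by
  have : (leftCols hmn U)ᴴ * leftCols hmn U =
      (Uᴴ * U).submatrix (Fin.castLE hmn) (Fin.castLE hmn) := rfl
  rw [this, hU, Matrix.submatrix_one _ (Fin.castLE_injective hmn)]

theorem rightCols_conjTranspose_mul_self (hmn : n ≤ m) (hU : Uᴴ * U = 1) :
    (rightCols hmn U)ᴴ * rightCols hmn U = 1 := by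
  have : (rightCols hmn U)ᴴ * rightCols hmn U =
      (Uᴴ * U).submatrix (fun j => Fin.cast (Nat.add_sub_of_le hmn) (Fin.natAdd n j))
        (fun j => Fin.cast (Nat.add_sub_of_le hmn) (Fin.natAdd n j)) := rfl
  rw [this, hU, Matrix.submatrix_one]
  intro i j hij
  simpa [Fin.ext_iff] using hij

theorem leftCols_conjTranspose_mul_rightCols (hmn : n ≤ m) (hU : Uᴴ * U = 1) :
    (leftCols hmn U)ᴴ * rightCols hmn U = 0 := by
  have : (leftCols hmn U)ᴴ * rightCols hmn U = (Uᴴ * U).submatrix (Fin.castLE hmn)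
      (fun j => Fin.cast (Nat.add_sub_of_le hmn) (Fin.natAdd n j)) := rfl
  rw [this, hU]
  ext i j
  rw [Matrix.submatrix_apply, Matrix.one_apply_ne, Matrix.zero_apply]
  intro h
  have := congrArg Fin.val h
  simp at this
  omega

theorem IsSVD.mul_right (h : IsSVD A U σ V) (hmn : n ≤ m) :
    A * V = leftCols hmn U * Matrix.diagonal (fun j => (σ j : 𝕜)) := by
  rw [h.decomposition, Matrix.mul_assoc, h.conjTranspose_mul_self_right, Matrix.mul_one]
  ext i j
  rw [Matrix.mul_diagonal, Matrix.mul_apply, Finset.sum_eq_single (Fin.castLE hmn j)]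
  · simp [sigmaMatrix, leftCols]
  · intro k _ hk
    have : (k : ℕ) ≠ j := fun e => hk (Fin.ext e)
    simp [sigmaMatrix, this]
  · simp

theorem IsSVD.conjTranspose_mul_left (h : IsSVD A U σ V) :
    Aᴴ * U = V * (sigmaMatrix 𝕜 m σ)ᴴ := by
  rw [h.decomposition, Matrix.conjTranspose_mul, Matrix.conjTranspose_mul,
    Matrix.conjTranspose_conjTranspose, Matrix.mul_assoc, Matrix.mul_assoc,
    h.conjTranspose_mul_self_left, Matrix.mul_one]

theorem IsSVD.conjTranspose_mul_leftCols (h : IsSVD A U σ V) (hmn : n ≤ m) :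
    Aᴴ * leftCols hmn U = V * Matrix.diagonal (fun j => (σ j : 𝕜)) := by
  have : Aᴴ * leftCols hmn U = (Aᴴ * U).submatrix id (Fin.castLE hmn) := rfl
  rw [this, h.conjTranspose_mul_left]
  ext i j
  rw [Matrix.mul_diagonal, Matrix.submatrix_apply, Matrix.mul_apply, Finset.sum_eq_single j]
  · simp [sigmaMatrix]
  · intro k _ hk
    have : (j : ℕ) ≠ k := fun e => hk (Fin.ext e.symm)
    simp [sigmaMatrix, this]
  · simp

theorem IsSVD.conjTranspose_mul_rightCols (h : IsSVD A U σ V) (hmn : n ≤ m) :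
    Aᴴ * rightCols hmn U = 0 := by
  have : Aᴴ * rightCols hmn U = (Aᴴ * U).submatrix id
    (fun j => Fin.cast (Nat.add_sub_of_le hmn) (Fin.natAdd n j)) := rfl
  rw [this, h.conjTranspose_mul_left]
  ext i j
  rw [Matrix.submatrix_apply, Matrix.mul_apply, Finset.sum_eq_zero, Matrix.zero_apply]
  intro k _
  have : n + (j : ℕ) ≠ k := by omega
  simp [sigmaMatrix, this]

theorem eigenvectorMatrix_conjTranspose_mul_self (hmn : n ≤ m) (hU : Uᴴ * U = 1)
    (hV : Vᴴ * V = 1) :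
    (eigenvectorMatrix hmn U V)ᴴ * eigenvectorMatrix hmn U V = 1 := by
  have h1 := leftCols_conjTranspose_mul_self hmn hU
  have h2 := rightCols_conjTranspose_mul_self hmn hU
  have h3 := leftCols_conjTranspose_mul_rightCols hmn hU
  have h4 : (rightCols hmn U)ᴴ * leftCols hmn U = 0 := by
    have := congrArg Matrix.conjTranspose h3
    simpa using this
  have hs : (1 / √2 : ℝ) * (1 / √2) = 1 / 2 := by
    rw [div_mul_div_comm, Real.mul_self_sqrt (by norm_num), one_mul]
  have hs2 : √2 * √2 = (2 : ℝ) := Real.mul_self_sqrt (by norm_num)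
  rw [eigenvectorMatrix, Matrix.conjTranspose_smul, Matrix.smul_mul, Matrix.mul_smul, smul_smul,
    star_trivial, hs, Matrix.fromBlocks_conjTranspose, Matrix.fromBlocks_multiply,
    Matrix.conjTranspose_fromCols_eq_fromRows_conjTranspose,
    Matrix.conjTranspose_fromCols_eq_fromRows_conjTranspose]
  simp only [Matrix.fromRows_mul, Matrix.mul_fromCols, Matrix.conjTranspose_smul,
    Matrix.conjTranspose_neg, Matrix.conjTranspose_zero, Matrix.neg_mul, Matrix.mul_neg,
    Matrix.smul_mul, Matrix.mul_smul, h1, h2, h3, h4, hV, Matrix.zero_mul, Matrix.mul_zero,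
    star_trivial, smul_zero]
  rw [show ∀ M N : Matrix (Fin n ⊕ (Fin n ⊕ Fin (m - n))) (Fin n ⊕ (Fin n ⊕ Fin (m - n))) 𝕜,
    (M = (2 : ℝ) • N → (1 / 2 : ℝ) • M = N) from fun M N h => by rw [h, smul_smul]; norm_num]
  ext i j
  rcases i with i | i | i <;> rcases j with j | j | j <;>
    simp [Matrix.one_apply, two_smul, smul_smul, hs2, ite_add_ite]

theorem augmented_mul_eigenvectorMatrix (h : IsSVD A U σ V) (hmn : n ≤ m) :
    augmented A * eigenvectorMatrix hmn U V =
      eigenvectorMatrix hmn U V * Matrix.diagonal (fun j => (augEigenvalue m σ j : 𝕜)) := by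
  have h1 := h.mul_right hmn
  have h2 := h.conjTranspose_mul_leftCols hmn
  have h3 := h.conjTranspose_mul_rightCols hmn
  rw [eigenvectorMatrix, Matrix.mul_smul, Matrix.smul_mul, augmented, Matrix.fromBlocks_multiply]
  simp only [Matrix.mul_fromCols, Matrix.mul_neg, Matrix.mul_smul, h1, h2, h3, Matrix.mul_zero,
    Matrix.zero_mul, smul_zero]
  congr 1
  ext i j
  rw [Matrix.mul_diagonal]
  rcases i with i | i <;> rcases j with j | j | j <;> simp [augEigenvalue]

theorem eigenvectorMatrix_mul_conjTranspose_self (hmn : n ≤ m) (hU : Uᴴ * U = 1)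
    (hV : Vᴴ * V = 1) :
    eigenvectorMatrix hmn U V * (eigenvectorMatrix hmn U V)ᴴ = 1 :=
  (Matrix.mul_eq_one_comm_of_card_eq _ _ _ (by simp; omega)).1
    (eigenvectorMatrix_conjTranspose_mul_self hmn hU hV)

theorem augmented_eq_conjDiagonal (h : IsSVD A U σ V) (hmn : n ≤ m)
    (h₁ : (eigenvectorMatrix hmn U V)ᴴ * eigenvectorMatrix hmn U V = 1)
    (h₂ : eigenvectorMatrix hmn U V * (eigenvectorMatrix hmn U V)ᴴ = 1) :
    augmented A = conjDiagonal (eigenvectorMatrix hmn U V) h₁ h₂ (augEigenvalue m σ) := by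
  rw [conjDiagonal_apply, ← augmented_mul_eigenvectorMatrix h hmn, Matrix.mul_assoc, h₂,
    Matrix.mul_one]

theorem approxProjector_eq_conjDiagonal (h : IsSVD A U σ V) (hmn : n ≤ m)
    (h₁ : (eigenvectorMatrix hmn U V)ᴴ * eigenvectorMatrix hmn U V = 1)
    (h₂ : eigenvectorMatrix hmn U V * (eigenvectorMatrix hmn U V)ᴴ = 1) (a b : ℝ) (d : ℕ) :
    approxProjector A a b d = conjDiagonal (eigenvectorMatrix hmn U V) h₁ h₂
      (fun j => (scaledChebJackson A a b d).eval (augEigenvalue m σ j / ‖A‖)) := by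
  rw [approxProjector, augmented_eq_conjDiagonal h hmn h₁ h₂, ← map_smul,
    Polynomial.aeval_algHom_apply, Polynomial.aeval_pi_apply]
  congr 1
  ext j
  rw [Polynomial.coe_aeval_eq_eval, Pi.smul_apply, smul_eq_mul, inv_mul_eq_div]

open Classical in
theorem selectedCols_mul_conjTranspose_apply (hmn : n ≤ m) (I : Set ℝ)
    [Fintype {j : Fin n // σ j ∈ I}] (i k : Fin n ⊕ Fin m) :
    (selectedCols hmn U σ V I * (selectedCols hmn U σ V I)ᴴ) i k =
      ∑ j, if σ j ∈ I then eigenvectorMatrix hmn U V i (Sum.inl j) *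
        star (eigenvectorMatrix hmn U V k (Sum.inl j)) else 0 := by
  rw [Matrix.mul_apply, ← Finset.sum_filter]
  symm
  exact Finset.sum_subtype _ (by simp) (fun j => eigenvectorMatrix hmn U V i (Sum.inl j) *
        star (eigenvectorMatrix hmn U V k (Sum.inl j)))

/-- The spectral projector is the step function of `[a, b]` applied to the augmented matrix:
as `a > 0`, the eigenvalues that are not singular values lie outside `[a, b]`. -/
theorem spectralProjector_eq_conjDiagonal (hmn : n ≤ m) (hσ : ∀ j, 0 ≤ σ j)
    (h₁ : (eigenvectorMatrix hmn U V)ᴴ * eigenvectorMatrix hmn U V = 1)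
    (h₂ : eigenvectorMatrix hmn U V * (eigenvectorMatrix hmn U V)ᴴ = 1) {a b : ℝ} (ha : 0 < a)
    (hab : a < b) :
    spectralProjector hmn U σ V a b = conjDiagonal (eigenvectorMatrix hmn U V) h₁ h₂
      (fun j => stepFunction a b (augEigenvalue m σ j)) := by
  classical
  rw [conjDiagonal_apply, spectralProjector]
  have h0 : ∀ x ≤ 0, stepFunction a b x = 0 := by
    intro x hx
    rw [stepFunction, if_neg (by intro h; linarith [h.1]),
      if_neg (by rintro (h | h) <;> linarith)]
  ext i k
  rw [Matrix.add_apply, Matrix.smul_apply, selectedCols_mul_conjTranspose_apply,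
    selectedCols_mul_conjTranspose_apply, Finset.smul_sum, ← Finset.sum_add_distrib,
    Matrix.mul_apply, Fintype.sum_sum_type, Fintype.sum_sum_type]
  simp only [Matrix.mul_diagonal, Matrix.conjTranspose_apply]
  rw [Finset.sum_eq_zero (s := Finset.univ) (f := fun j : Fin n =>
      eigenvectorMatrix hmn U V i (Sum.inr (Sum.inl j)) * _ * _),
    Finset.sum_eq_zero (s := Finset.univ) (f := fun j : Fin (m - n) =>
      eigenvectorMatrix hmn U V i (Sum.inr (Sum.inr j)) * _ * _), add_zero, add_zero]
  · refine Finset.sum_congr rfl fun j _ => ?_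
    simp only [stepFunction, augEigenvalue, Sum.elim_inl, Set.mem_Ioo, Set.mem_insert_iff,
      Set.mem_singleton_iff]
    by_cases h1 : a < σ j ∧ σ j < b
    · have h2 : ¬ (σ j = a ∨ σ j = b) := by rintro (h | h) <;> linarith [h1.1, h1.2]
      simp [h1, h2]
    · by_cases h2 : σ j = a ∨ σ j = b
      · simp only [h1, h2, if_true, if_false, RCLike.real_smul_eq_coe_mul]
        ring
      · simp [h1, h2]
  · intro j _
    simp [augEigenvalue, h0]
  · intro j _
    simp [augEigenvalue, h0 (-σ j) (by linarith [hσ j])]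

/-- The spectral norm is the largest singular value; `‖σ‖` is the supremum norm. -/
theorem IsSVD.norm_eq (h : IsSVD A U σ V) (hmn : n ≤ m) : ‖A‖ = ‖σ‖ := by
  have hAV : ‖A * V‖ = ‖σ‖ := by
    have h1 := Matrix.l2_opNorm_conjTranspose_mul_self (A * V)
    have h2 : (A * V)ᴴ * (A * V) = Matrix.diagonal (fun j => ((σ j ^ 2 : ℝ) : 𝕜)) := by
      rw [h.mul_right hmn, Matrix.conjTranspose_mul, Matrix.mul_assoc,
        ← Matrix.mul_assoc (leftCols hmn U)ᴴ,
        leftCols_conjTranspose_mul_self hmn h.conjTranspose_mul_self_left, Matrix.one_mul,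
        Matrix.diagonal_conjTranspose, Matrix.diagonal_mul_diagonal]
      congr 1
      ext j
      simp [sq]
    have h3 : ‖(fun j => ((σ j ^ 2 : ℝ) : 𝕜))‖ = ‖σ‖ * ‖σ‖ := by
      apply le_antisymm
      · refine (pi_norm_le_iff_of_nonneg (by positivity)).2 fun j => ?_
        rw [RCLike.norm_ofReal, abs_pow, ← Real.norm_eq_abs, sq]
        exact mul_self_le_mul_self (norm_nonneg _) (norm_le_pi_norm σ j)
      · have : ‖σ‖ ≤ √‖(fun j => ((σ j ^ 2 : ℝ) : 𝕜))‖ := by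
          refine (pi_norm_le_iff_of_nonneg (by positivity)).2 fun j => ?_
          apply Real.le_sqrt_of_sq_le
          have := norm_le_pi_norm (fun j => ((σ j ^ 2 : ℝ) : 𝕜)) j
          simpa using this
        have h4 := mul_self_le_mul_self (norm_nonneg _) this
        rwa [Real.mul_self_sqrt (norm_nonneg _)] at h4
    rw [h2, Matrix.l2_opNorm_diagonal, h3] at h1
    nlinarith [norm_nonneg (A * V), norm_nonneg σ]
  have h1 := Matrix.l2_opNorm_conjTranspose_mul_self (A * V)ᴴ
  have h2 := Matrix.l2_opNorm_conjTranspose_mul_self Aᴴ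
  rw [Matrix.conjTranspose_conjTranspose, Matrix.l2_opNorm_conjTranspose] at h1 h2
  rw [Matrix.conjTranspose_mul, Matrix.mul_assoc, ← Matrix.mul_assoc V,
    show V * Vᴴ = 1 from Matrix.mem_unitaryGroup_iff.1 h.right_unitary, Matrix.one_mul, h2,
    hAV] at h1
  nlinarith [norm_nonneg A, norm_nonneg σ]

end SVD

/-! ### Gaps between angles -/

/-- The gap to a fixed `c` grows as a point moves away from `c`; `arccos` being monotone on all of
`ℝ`, no bound on the points is needed. -/
theorem arccosGap_le_of_le {N x s c : ℝ} (hN : 0 < N) (h : x ≤ s ∧ s ≤ c ∨ c ≤ s ∧ s ≤ x) :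
    arccosGap N s c ≤ arccosGap N x c := by
  have key : ∀ {u v : ℝ}, u ≤ v → Real.arccos (v / N) ≤ Real.arccos (u / N) := fun huv =>
    Real.arccos_le_arccos (div_le_div_of_nonneg_right huv hN.le)
  unfold arccosGap
  rcases h with ⟨h1, h2⟩ | ⟨h1, h2⟩
  · rw [abs_of_nonneg (sub_nonneg.2 (key h2)), abs_of_nonneg (sub_nonneg.2 (key (h1.trans h2)))]
    linarith [key h1]
  · rw [abs_of_nonpos (sub_nonpos.2 (key h1)), abs_of_nonpos (sub_nonpos.2 (key (h1.trans h2)))]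
    linarith [key h2]

theorem arccosGap_le_of_le_right {N x c c' : ℝ} (hN : 0 < N)
    (h : x ≤ c ∧ c ≤ c' ∨ c' ≤ c ∧ c ≤ x) : arccosGap N x c ≤ arccosGap N x c' := by
  have := arccosGap_le_of_le (x := c') (s := c) (c := x) hN (by tauto)
  unfold arccosGap at *
  rwa [abs_sub_comm, abs_sub_comm (Real.arccos (x / N))]

theorem div_mem_Icc_of_abs_le {N x : ℝ} (hN : 0 < N) (hx : |x| ≤ N) :
    x / N ∈ Set.Icc (-1 : ℝ) 1 := by
  rw [abs_le] at hx
  exact ⟨by rw [le_div_iff₀ hN]; linarith, by rw [div_le_one hN]; exact hx.2⟩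

theorem arccosGap_pos {N s c : ℝ} (hN : 0 < N) (hs : |s| ≤ N) (hc : |c| ≤ N) (hne : s ≠ c) :
    0 < arccosGap N s c := by
  unfold arccosGap
  rw [abs_pos, sub_ne_zero]
  intro h
  have := Real.arccos_injOn (div_mem_Icc_of_abs_le hN hs) (div_mem_Icc_of_abs_le hN hc) h
  rw [div_left_inj' hN.ne'] at this
  exact hne this

theorem gaps_finite (m : ℕ) {n : ℕ} (σ : Fin n → ℝ) (N a b : ℝ) : (gaps m σ N a b).Finite := by
  have hl : ∀ (X : Set ℝ) (f : ℝ → ℝ), {δ | ∃ s, IsLeast X s ∧ δ = f s}.Finite := by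
    intro X f
    refine Set.Subsingleton.finite ?_
    rintro _ ⟨s, hs, rfl⟩ _ ⟨t, ht, rfl⟩
    rw [hs.unique ht]
  have hg : ∀ (X : Set ℝ) (f : ℝ → ℝ), {δ | ∃ s, IsGreatest X s ∧ δ = f s}.Finite := by
    intro X f
    refine Set.Subsingleton.finite ?_
    rintro _ ⟨s, hs, rfl⟩ _ ⟨t, ht, rfl⟩
    rw [hs.unique ht]
  exact (hl _ _).union ((hg _ _).union ((hg _ _).union (hl _ _)))

theorem exists_isLeast_of_finite {X : Set ℝ} (h : X.Finite) (hne : X.Nonempty) :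
    ∃ s, IsLeast X s := by
  obtain ⟨s, hs, h'⟩ := Set.exists_min_image X id h hne
  exact ⟨s, hs, h'⟩

theorem exists_isGreatest_of_finite {X : Set ℝ} (h : X.Finite) (hne : X.Nonempty) :
    ∃ s, IsGreatest X s := by
  obtain ⟨s, hs, h'⟩ := Set.exists_max_image X id h hne
  exact ⟨s, hs, h'⟩

section Gaps

variable {m n : ℕ} {σ : Fin n → ℝ} {N a b : ℝ}

theorem deltaMin_le {δ : ℝ} (h : δ ∈ gaps m σ N a b) : deltaMin m σ N a b ≤ δ :=
  csInf_le (gaps_finite m σ N a b).bddBelow h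

theorem exists_eq_singularValue_of_pos (hσ : ∀ j, 0 ≤ σ j) {j : Fin n ⊕ (Fin n ⊕ Fin (m - n))}
    (h : 0 < augEigenvalue m σ j) : ∃ k, j = Sum.inl k ∧ augEigenvalue m σ j = σ k := by
  rcases j with j | j | j
  · exact ⟨j, rfl, rfl⟩
  · simp only [augEigenvalue, Sum.elim_inr, Sum.elim_inl] at h
    linarith [hσ j]
  · simp [augEigenvalue] at h

theorem abs_augEigenvalue_le (hσ : ∀ j, 0 ≤ σ j) (hσN : ∀ j, σ j ≤ N) (hN : 0 < N)
    (j : Fin n ⊕ (Fin n ⊕ Fin (m - n))) : |augEigenvalue m σ j| ≤ N := by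
  rcases j with j | j | j
  · simpa [augEigenvalue, abs_of_nonneg (hσ j)] using hσN j
  · simpa [augEigenvalue, abs_of_nonneg (hσ j)] using hσN j
  · simpa [augEigenvalue] using hN.le

theorem deltaMin_le_of_lt_left (hN : 0 < N) {j : Fin n ⊕ (Fin n ⊕ Fin (m - n))}
    (h : augEigenvalue m σ j < a) :
    deltaMin m σ N a b ≤ arccosGap N (augEigenvalue m σ j) a := by
  obtain ⟨s, hs⟩ := exists_isGreatest_of_finite
    (X := {x | x ∈ Set.range (augEigenvalue m σ) ∧ x < a})
    ((Set.finite_range _).subset fun x hx => hx.1) ⟨_, ⟨j, rfl⟩, h⟩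
  exact (deltaMin_le (Or.inr (Or.inr (Or.inl ⟨s, hs, rfl⟩)))).trans
    (arccosGap_le_of_le hN (Or.inl ⟨hs.2 ⟨⟨j, rfl⟩, h⟩, hs.1.2.le⟩))

theorem deltaMin_le_of_gt_right (hN : 0 < N) {k : Fin n} (h : b < σ k) :
    deltaMin m σ N a b ≤ arccosGap N (σ k) b := by
  obtain ⟨s, hs⟩ := exists_isLeast_of_finite (X := {x | x ∈ Set.range σ ∧ b < x})
    ((Set.finite_range _).subset fun x hx => hx.1) ⟨_, ⟨k, rfl⟩, h⟩
  exact (deltaMin_le (Or.inr (Or.inr (Or.inr ⟨s, hs, rfl⟩)))).trans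
    (arccosGap_le_of_le hN (Or.inr ⟨hs.1.2.le, hs.2 ⟨⟨k, rfl⟩, h⟩⟩))

theorem deltaMin_le_arccosGap_left (hN : 0 < N) (hσ : ∀ j, 0 ≤ σ j) (ha : 0 < a) (hab : a < b)
    {j : Fin n ⊕ (Fin n ⊕ Fin (m - n))} (h : augEigenvalue m σ j ≠ a) :
    deltaMin m σ N a b ≤ arccosGap N (augEigenvalue m σ j) a := by
  rcases lt_or_gt_of_ne h with h | h
  · exact deltaMin_le_of_lt_left hN h
  obtain ⟨k, -, hk⟩ := exists_eq_singularValue_of_pos hσ (ha.trans h)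
  rw [hk] at h ⊢
  rcases le_or_gt (σ k) b with hb | hb
  · obtain ⟨s, hs⟩ := exists_isLeast_of_finite (X := {x | x ∈ Set.range σ ∧ a < x ∧ x ≤ b})
      ((Set.finite_range _).subset fun x hx => hx.1) ⟨_, ⟨k, rfl⟩, h, hb⟩
    exact (deltaMin_le (Or.inl ⟨s, hs, rfl⟩)).trans
      (arccosGap_le_of_le hN (Or.inr ⟨hs.1.2.1.le, hs.2 ⟨⟨k, rfl⟩, h, hb⟩⟩))
  · exact (deltaMin_le_of_gt_right hN hb).trans
      (arccosGap_le_of_le_right hN (Or.inr ⟨hab.le, hb.le⟩))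

theorem deltaMin_le_arccosGap_right (hN : 0 < N) (hσ : ∀ j, 0 ≤ σ j) (ha : 0 < a) (hab : a < b)
    {j : Fin n ⊕ (Fin n ⊕ Fin (m - n))} (h : augEigenvalue m σ j ≠ b) :
    deltaMin m σ N a b ≤ arccosGap N (augEigenvalue m σ j) b := by
  rcases lt_or_ge (augEigenvalue m σ j) a with h' | h'
  · exact (deltaMin_le_of_lt_left hN h').trans
      (arccosGap_le_of_le_right hN (Or.inl ⟨h'.le, hab.le⟩))
  obtain ⟨k, -, hk⟩ := exists_eq_singularValue_of_pos hσ (ha.trans_le h')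
  rw [hk] at h h' ⊢
  rcases lt_or_gt_of_ne h with hb | hb
  · obtain ⟨s, hs⟩ := exists_isGreatest_of_finite (X := {x | x ∈ Set.range σ ∧ a ≤ x ∧ x < b})
      ((Set.finite_range _).subset fun x hx => hx.1) ⟨_, ⟨k, rfl⟩, h', hb⟩
    exact (deltaMin_le (Or.inr (Or.inl ⟨s, hs, rfl⟩))).trans
      (arccosGap_le_of_le hN (Or.inl ⟨hs.2 ⟨⟨k, rfl⟩, h', hb⟩, hs.1.2.2.le⟩))
  · exact deltaMin_le_of_gt_right hN hb

theorem deltaMin_pos (hσ : ∀ j, 0 ≤ σ j) (hσN : ∀ j, σ j ≤ N) (ha : 0 < a) (hab : a < b)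
    (hb : b < N) (hmax : ∃ j, σ j = N) : 0 < deltaMin m σ N a b := by
  have hN : 0 < N := by linarith
  have hne : (gaps m σ N a b).Nonempty := by
    obtain ⟨k, hk⟩ := hmax
    obtain ⟨s, hs⟩ := exists_isLeast_of_finite (X := {x | x ∈ Set.range σ ∧ b < x})
      ((Set.finite_range _).subset fun x hx => hx.1) ⟨_, ⟨k, rfl⟩, by rwa [hk]⟩
    exact ⟨_, Or.inr (Or.inr (Or.inr ⟨s, hs, rfl⟩))⟩
  have hsv : ∀ s ∈ Set.range σ, |s| ≤ N := by
    rintro _ ⟨j, rfl⟩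
    rw [abs_of_nonneg (hσ j)]
    exact hσN j
  have ha' : |a| ≤ N := by rw [abs_of_pos ha]; linarith
  have hb' : |b| ≤ N := by rw [abs_of_pos (by linarith)]; exact hb.le
  have hmem : deltaMin m σ N a b ∈ gaps m σ N a b := hne.csInf_mem (gaps_finite m σ N a b)
  rcases hmem with ⟨s, hs, e⟩ | ⟨s, hs, e⟩ | ⟨s, hs, e⟩ | ⟨s, hs, e⟩ <;> rw [e]
  · exact arccosGap_pos hN (hsv s hs.1.1) ha' hs.1.2.1.ne'
  · exact arccosGap_pos hN (hsv s hs.1.1) hb' hs.1.2.2.ne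
  · obtain ⟨⟨j, rfl⟩, hj⟩ := hs.1
    exact arccosGap_pos hN (abs_augEigenvalue_le hσ hσN hN j) ha' hj.ne
  · exact arccosGap_pos hN (hsv s hs.1.1) hb' hs.1.2.ne'

/-- The largest singular value `N` lies above `b` and has angle `0`, so that `Δ_min` does not
exceed the angle of `b`. -/
theorem deltaMin_le_arccos (ha : 0 < a) (hab : a < b)
    (hb : b < N) (hmax : ∃ j, σ j = N) : deltaMin m σ N a b ≤ Real.arccos (b / N) := by
  have hN : 0 < N := by linarith
  obtain ⟨k, hk⟩ := hmax
  have h := deltaMin_le_of_gt_right (m := m) (σ := σ) (a := a) (b := b) hN (k := k) (by rwa [hk])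
  rwa [hk, arccosGap, div_self hN.ne', Real.arccos_one, zero_sub, abs_neg,
    abs_of_nonneg (Real.arccos_nonneg _)] at h

end Gaps

/-! ### Separation and ordering of the values -/

theorem stepFunction_div {N : ℝ} (hN : 0 < N) (a b x : ℝ) :
    stepFunction (a / N) (b / N) (x / N) = stepFunction a b x := by
  simp only [stepFunction, div_lt_div_iff_of_pos_right hN, div_left_inj' hN.ne']

theorem errorBound_lt {d : ℕ} {Δ : ℝ} (hΔ : 0 < Δ)
    (h : (d : ℝ) > (2 : ℝ) ^ (1 / 3 : ℝ) * Real.pi ^ 2 / Δ ^ (4 / 3 : ℝ) - 2) :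
    errorBound d Δ < 1 / 4 := by
  have hpi := Real.pi_pos
  have h1 : (2 : ℝ) ^ (1 / 3 : ℝ) * Real.pi ^ 2 / Δ ^ (4 / 3 : ℝ) < (d : ℝ) + 2 := by linarith
  have h2 := pow_lt_pow_left₀ h1 (by positivity) (by norm_num : 3 ≠ 0)
  have e1 : ((2 : ℝ) ^ (1 / 3 : ℝ)) ^ 3 = 2 := by
    rw [← Real.rpow_natCast, ← Real.rpow_mul (by norm_num)]; norm_num
  have e2 : (Δ ^ (4 / 3 : ℝ)) ^ 3 = Δ ^ 4 := by
    rw [← Real.rpow_natCast, ← Real.rpow_mul hΔ.le, ← Real.rpow_natCast]; norm_num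
  rw [div_pow, mul_pow, e1, e2, div_lt_iff₀ (by positivity)] at h2
  unfold errorBound
  rw [div_lt_div_iff₀ (by positivity) (by norm_num)]
  linarith

/-- An initial segment of `Fin M` is determined by its cardinality. -/
theorem mem_iff_lt_card_of_isLowerSet {M : ℕ} (S : Finset (Fin M))
    (h : ∀ i ∈ S, ∀ i' ≤ i, i' ∈ S) (i : Fin M) : i ∈ S ↔ (i : ℕ) < S.card := by
  constructor
  · intro hi
    have := Finset.card_le_card (s := Finset.Iic i) (t := S) fun i' hi' =>
      h i hi i' (Finset.mem_Iic.1 hi')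
    rw [Fin.card_Iic] at this
    omega
  · intro hi
    by_contra hn
    have := Finset.card_le_card (s := S) (t := Finset.Iio i) fun i' hi' =>
      Finset.mem_Iio.2 (lt_of_not_ge fun hle => hn (h i' hi' i hle))
    rw [Fin.card_Iio] at this
    omega

/-- As `a > 0`, the eigenvalues of the augmented matrix in `(a, b)` are the singular values in
`(a, b)`, with the same multiplicities. -/
theorem card_augEigenvalue_mem_Ioo {m n M : ℕ} {σ : Fin n → ℝ} (hσ : ∀ j, 0 ≤ σ j) {a b : ℝ}
    (ha : 0 < a) (e : Fin M ≃ Fin n ⊕ (Fin n ⊕ Fin (m - n))) :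
    Nat.card {i // augEigenvalue m σ (e i) ∈ Set.Ioo a b} = countIn σ (Set.Ioo a b) := by
  unfold countIn
  symm
  apply Nat.card_congr
  refine Equiv.ofBijective (fun j => ⟨e.symm (Sum.inl j.1), by
    rw [e.apply_symm_apply]; exact j.2⟩) ⟨?_, ?_⟩
  · intro j j' h
    simpa [Subtype.ext_iff] using h
  · rintro ⟨i, hi⟩
    obtain ⟨k, hk, hk'⟩ := exists_eq_singularValue_of_pos hσ (ha.trans hi.1)
    refine ⟨⟨k, by rwa [← hk']⟩, ?_⟩
    simp [← hk]

theorem stepFunction_of_mem_Ioo {a b x : ℝ} (h : x ∈ Set.Ioo a b) : stepFunction a b x = 1 :=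
  if_pos h

theorem stepFunction_of_eq {a b x : ℝ} (h : x = a ∨ x = b) : stepFunction a b x = 1 / 2 := by
  rw [stepFunction, if_neg, if_pos h]
  rintro ⟨h1, h2⟩
  rcases h with rfl | rfl
  · exact h1.false
  · exact h2.false

theorem stepFunction_of_notMem_Icc {a b x : ℝ} (hab : a < b) (h : x ∉ Set.Icc a b) :
    stepFunction a b x = 0 := by
  rw [stepFunction, if_neg fun h' => h ⟨h'.1.le, h'.2.le⟩, if_neg]
  rintro (rfl | rfl)
  · exact h ⟨le_rfl, hab.le⟩
  · exact h ⟨hab.le, le_rfl⟩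

theorem IsSVD.exists_eq_norm {𝕜 : Type*} [RCLike 𝕜] {m n : ℕ} {A : Matrix (Fin m) (Fin n) 𝕜}
    {U : Matrix (Fin m) (Fin m) 𝕜} {σ : Fin n → ℝ} {V : Matrix (Fin n) (Fin n) 𝕜}
    (h : IsSVD A U σ V) (hmn : n ≤ m) (hA : 0 < ‖A‖) : ∃ j, σ j = ‖A‖ := by
  have hne : Nonempty (Fin n) := by
    by_contra hn
    rw [not_nonempty_iff] at hn
    rw [h.norm_eq hmn, Subsingleton.elim σ 0, norm_zero] at hA
    exact hA.false
  obtain ⟨j, hj⟩ := Finite.exists_max σ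
  refine ⟨j, ?_⟩
  rw [h.norm_eq hmn]
  apply le_antisymm
  · exact (le_abs_self _).trans (norm_le_pi_norm σ j)
  · refine (pi_norm_le_iff_of_nonneg (h.nonneg j)).2 fun k => ?_
    rw [Real.norm_eq_abs, abs_of_nonneg (h.nonneg k)]
    exact hj k

theorem IsSVD.le_norm {𝕜 : Type*} [RCLike 𝕜] {m n : ℕ} {A : Matrix (Fin m) (Fin n) 𝕜}
    {U : Matrix (Fin m) (Fin m) 𝕜} {σ : Fin n → ℝ} {V : Matrix (Fin n) (Fin n) 𝕜}
    (h : IsSVD A U σ V) (hmn : n ≤ m) (j : Fin n) : σ j ≤ ‖A‖ := by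
  rw [h.norm_eq hmn]
  exact (le_abs_self _).trans (norm_le_pi_norm σ j)

end CJFeast

/-- `r` and `nsv` count the singular values in `(a, b)` and in `[a, b]`. An enumeration `e` of the
eigenvalues of `S_A` that puts the singular values in `[a, b]` first and orders the numbers
`γ i = φ_d(l(λ i))` decreasingly within the first `nsv` and within the remaining ones yields the
labelling of the eigenvalues of `P`. -/
theorem theorem5p1 {𝕜 : Type*} [RCLike 𝕜] {m n : ℕ} (hmn : n ≤ m)
    (A : Matrix (Fin m) (Fin n) 𝕜) (U : Matrix (Fin m) (Fin m) 𝕜) (σ : Fin n → ℝ)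
    (V : Matrix (Fin n) (Fin n) 𝕜) (hsvd : CJFeast.IsSVD A U σ V)
    (a b : ℝ) (ha : 0 < a) (hab : a < b) (hb : b < ‖A‖) (d : ℕ) :
    let PS := CJFeast.spectralProjector hmn U σ V a b
    let P := CJFeast.approxProjector A a b d
    let Δ := CJFeast.deltaMin m σ ‖A‖ a b
    let ev := CJFeast.augEigenvalue m σ
    let φ := fun x : ℝ => (CJFeast.scaledChebJackson A a b d).eval (x / ‖A‖)
    let r := CJFeast.countIn σ (Set.Ioo a b)
    let nsv := CJFeast.countIn σ (Set.Icc a b)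
    0 < Δ ∧
    ‖PS - P‖ ≤ Real.pi ^ 6 / (2 * ((d : ℝ) + 2) ^ 3 * Δ ^ 4) ∧
    P.charpoly = ∏ j, (Polynomial.X - Polynomial.C ((φ (ev j) : ℝ) : 𝕜)) ∧
    ((d : ℝ) > (2 : ℝ) ^ (1 / 3 : ℝ) * Real.pi ^ 2 / Δ ^ (4 / 3 : ℝ) - 2 →
      ‖PS - P‖ < 1 / 4 ∧
      (∀ j, ev j ∈ Set.Ioo a b → 3 / 4 < φ (ev j) ∧ φ (ev j) ≤ 1) ∧
      (∀ j, ev j = a ∨ ev j = b → 1 / 4 < φ (ev j) ∧ φ (ev j) < 3 / 4) ∧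
      (∀ j, ev j ∉ Set.Icc a b → 0 ≤ φ (ev j) ∧ φ (ev j) < 1 / 4) ∧
      (∀ e : Fin (m + n) ≃ Fin n ⊕ (Fin n ⊕ Fin (m - n)),
        (∀ i : Fin (m + n), (i : ℕ) < nsv ↔ ev (e i) ∈ Set.Icc a b) →
        (∀ i i' : Fin (m + n), i ≤ i' → (i' : ℕ) < nsv → φ (ev (e i')) ≤ φ (ev (e i))) →
        (∀ i i' : Fin (m + n), i ≤ i' → nsv ≤ (i : ℕ) → φ (ev (e i')) ≤ φ (ev (e i))) →
        Antitone (fun i => φ (ev (e i))) ∧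
        (∀ i : Fin (m + n), φ (ev (e i)) ≤ 1 ∧ 0 ≤ φ (ev (e i))) ∧
        (∀ i : Fin (m + n), (i : ℕ) < r → ev (e i) ∈ Set.Ioo a b ∧ 3 / 4 < φ (ev (e i))) ∧
        (∀ i : Fin (m + n), r ≤ (i : ℕ) → (i : ℕ) < nsv →
          (ev (e i) = a ∨ ev (e i) = b) ∧ 1 / 4 < φ (ev (e i)) ∧ φ (ev (e i)) < 3 / 4) ∧
        (∀ i : Fin (m + n), nsv ≤ (i : ℕ) → φ (ev (e i)) < 1 / 4))) := by
  intro PS P Δ ev φ r nsv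
  have hN : 0 < ‖A‖ := by linarith
  have hσ := hsvd.nonneg
  have hσN := hsvd.le_norm hmn
  have hmax := hsvd.exists_eq_norm hmn hN
  have hΔ : 0 < Δ := CJFeast.deltaMin_pos hσ hσN ha hab hb hmax
  have hU := hsvd.conjTranspose_mul_self_left
  have hV := hsvd.conjTranspose_mul_self_right
  have h₁ := CJFeast.eigenvectorMatrix_conjTranspose_mul_self hmn hU hV
  have h₂ := CJFeast.eigenvectorMatrix_mul_conjTranspose_self hmn hU hV
  have hmem : ∀ j, ev j / ‖A‖ ∈ Set.Icc (-1 : ℝ) 1 := fun j =>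
    CJFeast.div_mem_Icc_of_abs_le hN (CJFeast.abs_augEigenvalue_le hσ hσN hN j)
  have hrange : ∀ j, φ (ev j) ∈ Set.Icc (0 : ℝ) 1 := fun j =>
    CJFeast.eval_chebJackson_mem_Icc (div_le_div_of_nonneg_right hab.le hN.le) (hmem j) d
  have herr : ∀ j, |CJFeast.stepFunction a b (ev j) - φ (ev j)| ≤ CJFeast.errorBound d Δ := by
    intro j
    rw [← CJFeast.stepFunction_div hN]
    exact CJFeast.abs_stepFunction_sub_eval_le (div_pos ha hN)
      ((div_lt_div_iff_of_pos_right hN).2 hab) ((div_lt_one hN).2 hb) (hmem j) hΔ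
      (CJFeast.deltaMin_le_arccos ha hab hb hmax)
      (fun h => CJFeast.deltaMin_le_arccosGap_left hN hσ ha hab fun h' => h (by rw [← h']))
      (fun h => CJFeast.deltaMin_le_arccosGap_right hN hσ ha hab fun h' => h (by rw [← h'])) d
  have hP : P = CJFeast.conjDiagonal _ h₁ h₂ (fun j => φ (ev j)) :=
    CJFeast.approxProjector_eq_conjDiagonal hsvd hmn h₁ h₂ a b d
  have hPS : PS = CJFeast.conjDiagonal _ h₁ h₂ (fun j => CJFeast.stepFunction a b (ev j)) :=
    CJFeast.spectralProjector_eq_conjDiagonal hmn hσ h₁ h₂ ha hab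
  have hnorm : ‖PS - P‖ ≤ CJFeast.errorBound d Δ := by
    rw [hP, hPS, ← map_sub]
    exact CJFeast.norm_conjDiagonal_le _ h₁ h₂ _ (CJFeast.errorBound_nonneg d Δ) herr
  refine ⟨hΔ, hnorm, ?_, fun hd => ?_⟩
  · rw [hP]
    exact CJFeast.charpoly_conjDiagonal _ h₁ h₂ (by simp; omega) _
  have hE := CJFeast.errorBound_lt hΔ hd
  have herr' := fun j => abs_lt.1 ((herr j).trans_lt hE)
  have hin : ∀ j, ev j ∈ Set.Ioo a b → 3 / 4 < φ (ev j) ∧ φ (ev j) ≤ 1 := by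
    intro j hj
    have := herr' j
    rw [CJFeast.stepFunction_of_mem_Ioo hj] at this
    exact ⟨by linarith [this.2], (hrange j).2⟩
  have hends : ∀ j, ev j = a ∨ ev j = b → 1 / 4 < φ (ev j) ∧ φ (ev j) < 3 / 4 := by
    intro j hj
    have := herr' j
    rw [CJFeast.stepFunction_of_eq hj] at this
    exact ⟨by linarith [this.2], by linarith [this.1]⟩
  have hout : ∀ j, ev j ∉ Set.Icc a b → 0 ≤ φ (ev j) ∧ φ (ev j) < 1 / 4 := by
    intro j hj
    have := herr' j
    rw [CJFeast.stepFunction_of_notMem_Icc hab hj] at this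
    exact ⟨(hrange j).1, by linarith [this.1]⟩
  refine ⟨hnorm.trans_lt hE, hin, hends, hout, fun e he hanti₁ hanti₂ => ?_⟩
  have hcases : ∀ j, ev j ∈ Set.Icc a b → ev j ∈ Set.Ioo a b ∨ (ev j = a ∨ ev j = b) := by
    intro j hj
    rcases eq_or_lt_of_le hj.1 with h | h
    · exact Or.inr (Or.inl h.symm)
    rcases eq_or_lt_of_le hj.2 with h' | h'
    · exact Or.inr (Or.inr h')
    · exact Or.inl ⟨h, h'⟩
  have hfirst : ∀ i : Fin (m + n), (i : ℕ) < nsv → 1 / 4 < φ (ev (e i)) := by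
    intro i hi
    rcases hcases _ ((he i).1 hi) with h | h
    · linarith [(hin _ h).1]
    · exact (hends _ h).1
  have hlast : ∀ i : Fin (m + n), nsv ≤ (i : ℕ) → φ (ev (e i)) < 1 / 4 := fun i hi =>
    (hout _ fun h => absurd ((he i).2 h) (not_lt.2 hi)).2
  have hr : ∀ i : Fin (m + n), ev (e i) ∈ Set.Ioo a b ↔ (i : ℕ) < r := by
    classical
    intro i
    -- The indices of the eigenvalues in `(a, b)` form an initial segment, because the values of
    -- `φ` at the endpoints are smaller than those inside.
    have h := CJFeast.mem_iff_lt_card_of_isLowerSet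
      (Finset.univ.filter fun i => ev (e i) ∈ Set.Ioo a b) (by
        intro i hi i' hi'
        rw [Finset.mem_filter_univ] at hi ⊢
        have hlt : (i : ℕ) < nsv := (he i).2 (Set.Ioo_subset_Icc_self hi)
        have hle : (i' : ℕ) ≤ i := hi'
        rcases hcases _ ((he i').1 (hle.trans_lt hlt)) with h | h
        · exact h
        · linarith [(hends _ h).2, (hin _ hi).1, hanti₁ i' i hi' hlt]) i
    rw [Finset.mem_filter_univ, ← Fintype.card_subtype, ← Nat.card_eq_fintype_card,
      CJFeast.card_augEigenvalue_mem_Ioo hσ ha e] at h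
    exact h
  refine ⟨fun i i' hi => ?_, fun i => ⟨(hrange _).2, (hrange _).1⟩,
    fun i hi => ⟨(hr i).2 hi, (hin _ ((hr i).2 hi)).1⟩, fun i hi hi' => ?_, hlast⟩
  · rcases lt_or_ge (i' : ℕ) nsv with h' | h'
    · exact hanti₁ i i' hi h'
    rcases lt_or_ge (i : ℕ) nsv with h | h
    · exact ((hlast i' h').trans (hfirst i h)).le
    · exact hanti₂ i i' hi h
  · have h : ev (e i) = a ∨ ev (e i) = b :=
      (hcases _ ((he i).1 hi')).resolve_left fun h => absurd ((hr i).1 h) (not_lt.2 hi)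
    exact ⟨h, hends _ h⟩
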